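/- Let $d\ge 2$ and $\alpha=\frac d2-1$. For each $k\ge 0$ let $(Y_k^h)_{h\in\mathcal H_k}$ be a (finite) orthonormal basis, for the surface measure on $S^{d-1}$, of the space of complex hyperspherical harmonics of degree $k$ (restrictions to $S^{d-1}$ of complex harmonic polynomials on $\mathbb R^d$ that are homogeneous of degree $k$), and for $\mathbf x\neq 0$ write $Y_k^h(\mathbf x)=Y_k^h(\mathbf x/|\mathbf x|)$ (for $\mathbf x = 0$ put $Y_k^h(0)=0$ if $k\ge1$, and let $Y_0^h(0)$ be the constant value of $Y_0^h$). Let $K$ be a complex-valued function that is real-analytic on $(0,\infty)$, and let $\mathbf r,\mathbf r'\in\mathbb R^d$ with $r=|\mathbf r|>0$ and $r'=|\mathbf r'|$. Assume that $r',r$ lie within the radius of convergence $R\in(0,\infty]$ of the Taylor series of $\varepsilon\mapsto K(r\sqrt{1+\varepsilon})$ at $\varepsilon=0$, in the sense that $\left|\frac{r'}r\left(\frac{r'}r-2\cos\gamma\right)\right|<R$ for every angle $\gamma$; if $\mathbf r'=\mathbf r$, assume also that $K$ is continuous from the right at $0$. Then \[ K(|\mathbf r'-\mathbf r|)=\sum_{k=0}^\infty\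 \sum_{h\in\mathcal H_k} Y_k^h(\mathbf r)\,Y_k^h(\mathbf r')^*\,\mathcal K^{(k)}(r',r), \qquad \mathcal K^{(k)}(r',r)=\sum_{j=k}^\infty r'^j\sum_{m=0}^j K^{(m)}(r)\,r^{m-j}\,\mathcal T^{(\alpha)}_{jkm}, \] where the series over $k$ and, for every $k$, the series over $j$ converge absolutely. The constants depend only on the dimension; they are \[ \mathcal T^{(\alpha)}_{jkm}=\sum_{n=\max(\lceil (j+k)/2\rceil,\,m)}^{j} a_{k,2n-j}\,(-2)^{2n-j}\binom{n}{2n-j}\frac{1}{n!}\,\mathcal B_{nm}, \] where \[ a_{k,i}=\frac{2\pi^{d/2}}{\Gamma(d/2)}\cdot\frac{i!}{2^i\,\left(\frac{i-k}2\right)!\,(d/2)_{(i+k)/2}}\quad\text{if } k\le i,\ k\equiv i \bmod 2,\qquad a_{k,i}=0\ \text{otherwise}, \] $(a)_n=a(a+1)\cdots(a+n-1)$, and \[ \mathcal B_{nm}=(-1)^{n+m}\frac{(2n-2m-1)!!}{2^n}\binom{2n-m-1}{m-1}\quad(n\ge m\ge 1),\qquad \mathcal B_{00}=1,\quad \mathcal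 B_{n0}=0\ (n\ge 1), \] with $(-1)!!=1$. In particular $\mathcal T^{(\alpha)}_{jk0}=0$ unless $j=k=0$. -/

import Mathlib

open scoped Nat

noncomputable section

namespace FKT

/-- Euclidean space `ℝᵈ`. -/
abbrev E (d : ℕ) : Type := EuclideanSpace ℝ (Fin d)

/-- Complex polynomials in `d` variables, homogeneous of degree `k` and annihilated by the
Laplacian `∑ᵢ ∂ᵢ²`. -/
def solidHarmonics (d k : ℕ) : Submodule ℂ (MvPolynomial (Fin d) ℂ) where
  carrier := {p | p.IsHomogeneous k ∧
    ∑ i, MvPolynomial.pderiv i (MvPolynomial.pderiv i p) = 0}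
  add_mem' := by
    rintro p q ⟨hp, hp'⟩ ⟨hq, hq'⟩
    refine ⟨hp.add hq, ?_⟩
    simp [Finset.sum_add_distrib, hp', hq']
  zero_mem' := ⟨MvPolynomial.isHomogeneous_zero _ _ _, by simp⟩
  smul_mem' := by
    rintro c p ⟨hp, hp'⟩
    refine ⟨(MvPolynomial.homogeneousSubmodule (Fin d) ℂ k).smul_mem c hp, ?_⟩
    simp [← Finset.smul_sum, hp']

/-- The angular part `x ↦ p (x / |x|)` of a polynomial. (At `x = 0`, where there is no direction,
this is `p 0`; so the angular part of a constant is that constant on all of `ℝᵈ`.) -/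
def angularPart (d : ℕ) : MvPolynomial (Fin d) ℂ →ₗ[ℂ] (E d → ℂ) where
  toFun p x := MvPolynomial.eval (fun i => (((‖x‖⁻¹ • x) i : ℝ) : ℂ)) p
  map_add' p q := by ext x; simp
  map_smul' c p := by ext x; simp

/-- The space of hyperspherical harmonics of degree `k` on `ℝᵈ`, as functions of the direction
`x / |x|` of the vector `x`. -/
def hypersphericalHarmonics (d k : ℕ) : Submodule ℂ (E d → ℂ) :=
  (solidHarmonics d k).map (angularPart d)

/-- `Y` is an orthonormal basis of the space of hyperspherical harmonics of degree `k`, for the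
surface measure on the unit sphere. -/
structure IsHarmonicBasis (d k : ℕ) {ι : Type*} (Y : ι → E d → ℂ) : Prop where
  span_eq : Submodule.span ℂ (Set.range Y) = hypersphericalHarmonics d k
  norm_one : ∀ h, ∫ ω : Metric.sphere (0 : E d) 1,
    Y h ω * starRingEnd ℂ (Y h ω) ∂(MeasureTheory.volume : MeasureTheory.Measure (E d)).toSphere = 1
  orthogonal : ∀ h h', h ≠ h' → ∫ ω : Metric.sphere (0 : E d) 1,
    Y h ω * starRingEnd ℂ (Y h' ω) ∂(MeasureTheory.volume : MeasureTheory.Measure (E d)).toSphere = 0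

/-- `ε = (r'/r) (r'/r - 2 cos γ)`, so that `|x' - x| = r √(1 + ε)` when `|x| = r`, `|x'| = r'` and
the angle between `x` and `x'` is `γ`. -/
def eps (r' r γ : ℝ) : ℝ := r' / r * (r' / r - 2 * Real.cos γ)

/-- The radius of convergence of the Taylor series at `ε = 0` of `ε ↦ K (r √(1 + ε))`. -/
def taylorRadius (K : ℝ → ℂ) (r : ℝ) : ENNReal :=
  (FormalMultilinearSeries.ofScalars ℂ (fun n : ℕ =>
    iteratedDeriv n (fun ε : ℝ => K (r * √(1 + ε))) 0 / (n ! : ℂ))).radius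

/-- The area `2 π^(d/2) / Γ(d/2)` of the unit sphere of `ℝᵈ`. -/
def sphereArea (d : ℕ) : ℝ := 2 * Real.pi ^ ((d : ℝ) / 2) / Real.Gamma ((d : ℝ) / 2)

/-- The coefficient of `∑ₕ Yₖʰ(x) Yₖʰ(y)*` in the expansion of `(x ⬝ y) ^ i` over the unit sphere.
With `α = d/2 - 1 > 0` it is `Zₖ * Aₖᵢ`, where
`Aₖᵢ = i! (α + k) / (2ⁱ ((i-k)/2)! (α)₍₍ᵢ₊ₖ₎/₂₊₁₎)` (for `k ≤ i`, `k ≡ i mod 2`) are the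
coefficients of `tⁱ` over the Gegenbauer polynomials `Cₖ^α(t)`, and
`Zₖ = sphereArea d * α / (α + k)` is the constant of the addition theorem. After cancellation of
`α (α + k)` the product makes sense for `d = 2`, `α = 0` as well. -/
def ZA (d k i : ℕ) : ℝ :=
  if k ≤ i ∧ Even (i - k) then
    sphereArea d * (i ! : ℝ) /
      (2 ^ i * (((i - k) / 2) ! : ℝ) * (ascPochhammer ℝ ((i + k) / 2)).eval ((d : ℝ) / 2))
  else 0

/-- The numbers `Bₙₘ` with `(d/dε)ⁿ K (r √(1 + ε)) = ∑ₘ Bₙₘ K⁽ᵐ⁾(r) rᵐ` at `ε = 0`, with the usual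
conventions `B₀₀ = 1` and `Bₙ₀ = 0` for `n > 0`. (Here `(-1)‼ = 1`.) -/
def B (n m : ℕ) : ℝ :=
  if m = 0 then (if n = 0 then 1 else 0)
  else if n < m then 0
  else (-1) ^ (n + m) * ((2 * n - 2 * m - 1)‼ : ℝ) / 2 ^ n * ((2 * n - m - 1).choose (m - 1) : ℝ)

/-- The constants `T_{jkm}` in dimension `d`. -/
def T (d j k m : ℕ) : ℝ :=
  ∑ n ∈ Finset.Icc (max ((j + k + 1) / 2) m) j,
    ZA d k (2 * n - j) * (-2) ^ (2 * n - j) * (n.choose (2 * n - j) : ℝ) / (n ! : ℝ) * B n m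

/-- The `j`-th term `r'^j ∑ₘ K⁽ᵐ⁾(r) r^(m-j) T_{jkm}` of the radial factor. The summand `m = 0`
vanishes unless `j = k = 0`. -/
def radialTerm (d : ℕ) (K : ℝ → ℂ) (k : ℕ) (r' r : ℝ) (j : ℕ) : ℂ :=
  (r' : ℂ) ^ j * ∑ m ∈ Finset.Icc 0 j,
    iteratedDeriv m K r * (r : ℂ) ^ ((m : ℤ) - (j : ℤ)) * (T d j k m : ℂ)

/-- The radial factor `𝒦⁽ᵏ⁾(r', r) = ∑_{j ≥ k} r'^j ∑ₘ K⁽ᵐ⁾(r) r^(m-j) T_{jkm}`. -/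
def radialFactor (d : ℕ) (K : ℝ → ℂ) (k : ℕ) (r' r : ℝ) : ℂ :=
  ∑' i : ℕ, radialTerm d K k r' r (k + i)

end FKT

end

/-! Put s = r'/r and let t be the cosine of the angle between the two vectors, so that |x' - x| = r
√(1 + ε) with ε = s² - 2st. Expand ε ↦ K(r √(1 + ε)) in its Taylor series, expand εⁿ by the binomial
theorem, and expand each power tⁱ in harmonics. The result is a series over triples (i, q, k) with n
= i + q; summing over i and q first, grouped by the power j = i + 2q of r', gives the radial
factors.

Taylor part: `iteratedDeriv_sqrtComp` computes the coefficients through a recursion for `B`, and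
`hasSum_taylorCoeff` shows by the identity theorem that the series represents the function, up to
the endpoint ε = -1.

Harmonic part: `inner_pow_eq_sum_kernel` expands tⁱ. On the sphere, a power of a linear form is a
sum of harmonics (`mem_harmonicSpan`), and its coefficients come from Funk–Hecke. The integrals are
evaluated against the Gaussian, where multiplication by a coordinate integrates by parts to a
derivative; polar coordinates then lead to the sphere. Gegenbauer polynomials never enter, so d = 2
is not exceptional.

Convergence: at γ = π the binomial expansion of ε has no cancellation, so absolute convergence there
bounds all (i, q) terms. For fixed i the k-sum costs at most a factor 1
(`sum_ZA_mul_norm_kernel_le`). This justifies the interchange in `hasSum_kernel_mul`. -/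

noncomputable section

/-! ### Solid harmonics and the decomposition of homogeneous polynomials -/

namespace FKT

open MvPolynomial

variable {d : ℕ}

/-- The Laplacian `∑ᵢ ∂ᵢ²` on complex polynomials. -/
def laplacian (d : ℕ) : MvPolynomial (Fin d) ℂ →ₗ[ℂ] MvPolynomial (Fin d) ℂ :=
  ∑ i, (pderiv i).toLinearMap ∘ₗ (pderiv i).toLinearMap

lemma laplacian_apply (p : MvPolynomial (Fin d) ℂ) :
    laplacian d p = ∑ i, pderiv i (pderiv i p) := by
  simp [laplacian]

lemma mem_solidHarmonics {k : ℕ} {p : MvPolynomial (Fin d) ℂ} :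
    p ∈ solidHarmonics d k ↔ p.IsHomogeneous k ∧ laplacian d p = 0 := by
  rw [laplacian_apply]; rfl

/-- The polynomial `∑ᵢ Xᵢ²`. -/
def normSqPoly (d : ℕ) : MvPolynomial (Fin d) ℂ := ∑ i, X i ^ 2

lemma isHomogeneous_normSqPoly : (normSqPoly d).IsHomogeneous 2 :=
  IsHomogeneous.sum _ _ _ fun i _ => isHomogeneous_X_pow i 2

lemma pderiv_normSqPoly (i : Fin d) : pderiv i (normSqPoly d) = 2 * X i := by
  simp only [normSqPoly, map_sum, pderiv_pow]
  rw [Finset.sum_eq_single i]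
  · simp
  · intro j _ hj
    rw [pderiv_X_of_ne hj]; simp
  · simp

/-- Leibniz rule: Δ|x|² contributes 2d, and the cross term 4 x·∇f equals 4m f by Euler's identity.
-/
lemma laplacian_normSqPoly_mul {m : ℕ} {f : MvPolynomial (Fin d) ℂ} (hf : f.IsHomogeneous m) :
    laplacian d (normSqPoly d * f) =
      ((2 * d + 4 * m : ℕ) : ℂ) • f + normSqPoly d * laplacian d f := by
  have key : ∀ i : Fin d, pderiv i (pderiv i (normSqPoly d * f)) =
      2 * f + 4 * (X i * pderiv i f) + normSqPoly d * pderiv i (pderiv i f) := by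
    intro i
    have h2 : pderiv i (2 : MvPolynomial (Fin d) ℂ) = 0 := by
      rw [← map_ofNat C 2, pderiv_C]
    simp only [pderiv_mul, map_add, pderiv_normSqPoly, h2, pderiv_X_self]
    ring
  rw [laplacian_apply, laplacian_apply, Finset.sum_congr rfl fun i _ => key i,
    Finset.sum_add_distrib, Finset.sum_add_distrib, ← Finset.mul_sum, ← Finset.mul_sum,
    ← Finset.mul_sum, hf.sum_X_mul_pderiv]
  simp only [Finset.sum_const, Finset.card_univ, Fintype.card_fin, nsmul_eq_mul, smul_eq_C_mul,
    map_natCast]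
  push_cast
  ring

lemma IsHomogeneous.normSqPoly_pow_mul {m : ℕ} {f : MvPolynomial (Fin d) ℂ}
    (hf : f.IsHomogeneous m) (j : ℕ) : (normSqPoly d ^ j * f).IsHomogeneous (2 * j + m) :=
  (isHomogeneous_normSqPoly.pow j).mul hf

lemma laplacian_normSqPoly_pow_mul {m : ℕ} {f : MvPolynomial (Fin d) ℂ}
    (hf : f ∈ solidHarmonics d m) (j : ℕ) :
    laplacian d (normSqPoly d ^ (j + 1) * f) =
      ((2 * (j + 1) * (d + 2 * m + 2 * j) : ℕ) : ℂ) • (normSqPoly d ^ j * f) := by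
  obtain ⟨hf, hf0⟩ := mem_solidHarmonics.1 hf
  induction j with
  | zero =>
    rw [zero_add, pow_one, laplacian_normSqPoly_mul hf, hf0]
    simp only [mul_zero, add_zero, pow_zero, one_mul, mul_one]
    congr 2
    ring
  | succ j ih =>
    rw [pow_succ', mul_assoc, laplacian_normSqPoly_mul (IsHomogeneous.normSqPoly_pow_mul hf _), ih]
    simp only [smul_eq_C_mul, map_natCast]
    push_cast
    ring

/-- The span of the polynomials `|x|^(2j) h` of degree `n` with `h` a solid harmonic. -/
def harmonicSpan (d n : ℕ) : Submodule ℂ (MvPolynomial (Fin d) ℂ) :=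
  Submodule.span ℂ {f | ∃ j m, 2 * j + m = n ∧ ∃ h ∈ solidHarmonics d m, f = normSqPoly d ^ j * h}

/-- The Laplacian sends |x|^(2j+2) h to a nonzero multiple of |x|^(2j) h, so it can be inverted
within these spans. -/
lemma exists_laplacian_eq (hd : 0 < d) {n : ℕ} {f : MvPolynomial (Fin d) ℂ}
    (hf : f ∈ harmonicSpan d n) :
    ∃ u ∈ harmonicSpan d (n + 2), u.IsHomogeneous (n + 2) ∧ laplacian d u = f := by
  induction hf using Submodule.span_induction with
  | mem f hf =>
    obtain ⟨j, m, hn, h, hh, rfl⟩ := hf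
    have hc : ((2 * (j + 1) * (d + 2 * m + 2 * j) : ℕ) : ℂ) ≠ 0 := by
      rw [Nat.cast_ne_zero]; positivity
    have e : 2 * (j + 1) + m = n + 2 := by omega
    refine ⟨((2 * (j + 1) * (d + 2 * m + 2 * j) : ℕ) : ℂ)⁻¹ • (normSqPoly d ^ (j + 1) * h),
      ?_, ?_, ?_⟩
    · exact Submodule.smul_mem _ _ (Submodule.subset_span ⟨j + 1, m, e, h, hh, rfl⟩)
    · rw [← e]
      exact (homogeneousSubmodule (Fin d) ℂ _).smul_mem _
        (IsHomogeneous.normSqPoly_pow_mul hh.1 _)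
    · rw [map_smul, laplacian_normSqPoly_pow_mul hh, inv_smul_smul₀ hc]
  | zero => exact ⟨0, Submodule.zero_mem _, isHomogeneous_zero _ _ _, map_zero _⟩
  | add f g _ _ hf hg =>
    obtain ⟨u, hu, hu', rfl⟩ := hf
    obtain ⟨v, hv, hv', rfl⟩ := hg
    exact ⟨u + v, Submodule.add_mem _ hu hv, hu'.add hv', map_add _ _ _⟩
  | smul c f _ hf =>
    obtain ⟨u, hu, hu', rfl⟩ := hf
    exact ⟨c • u, Submodule.smul_mem _ _ hu, (homogeneousSubmodule (Fin d) ℂ _).smul_mem _ hu',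
      map_smul _ _ _⟩

lemma IsHomogeneous.laplacian {n : ℕ} {f : MvPolynomial (Fin d) ℂ} (hf : f.IsHomogeneous n) :
    (laplacian d f).IsHomogeneous (n - 2) := by
  rw [laplacian_apply]
  exact IsHomogeneous.sum _ _ _ fun i _ => by simpa [Nat.sub_sub] using hf.pderiv.pderiv

lemma laplacian_eq_zero {n : ℕ} (hn : n < 2) {f : MvPolynomial (Fin d) ℂ}
    (hf : f.IsHomogeneous n) : laplacian d f = 0 := by
  rw [laplacian_apply]
  refine Finset.sum_eq_zero fun i _ => ?_
  have h0 : (pderiv i f).IsHomogeneous 0 := by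
    have := hf.pderiv (i := i)
    rwa [show n - 1 = 0 by omega] at this
  rw [totalDegree_eq_zero_iff_eq_C.1 ((totalDegree_zero_iff_isHomogeneous _).2 h0), pderiv_C]

/-- Every homogeneous polynomial is a combination of products of powers of `|x|²` and solid
harmonics. -/
theorem mem_harmonicSpan (hd : 0 < d) : ∀ {n : ℕ} {f : MvPolynomial (Fin d) ℂ},
    f.IsHomogeneous n → f ∈ harmonicSpan d n := by
  intro n
  induction n using Nat.strong_induction_on with
  | _ n ih =>
    intro f hf
    have harm : ∀ {g : MvPolynomial (Fin d) ℂ}, g.IsHomogeneous n → laplacian d g = 0 →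
        g ∈ harmonicSpan d n := fun {g} hg h0 =>
      Submodule.subset_span ⟨0, n, by omega, g, mem_solidHarmonics.2 ⟨hg, h0⟩, by simp⟩
    rcases lt_or_ge n 2 with hn | hn
    · exact harm hf (laplacian_eq_zero hn hf)
    · obtain ⟨m, rfl⟩ := Nat.exists_eq_add_of_le' hn
      -- By induction Δf lies in the span of degree n - 2, hence Δf = Δu with u in the span; the
      -- difference f - u is harmonic.
      obtain ⟨u, hu, hu', hfu⟩ :=
        exists_laplacian_eq hd (ih m (by omega) (IsHomogeneous.laplacian hf))
      rw [← sub_add_cancel f u]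
      exact Submodule.add_mem _ (harm (hf.sub hu') (by rw [map_sub, hfu, sub_self])) hu

lemma map_conj_mem_solidHarmonics {k : ℕ} {p : MvPolynomial (Fin d) ℂ}
    (hp : p ∈ solidHarmonics d k) : map (starRingEnd ℂ) p ∈ solidHarmonics d k := by
  rw [mem_solidHarmonics] at hp ⊢
  refine ⟨hp.1.map _, ?_⟩
  have := congrArg (map (starRingEnd ℂ)) hp.2
  simpa [laplacian_apply, pderiv_map] using this

lemma pderiv_mem_solidHarmonics {k : ℕ} {p : MvPolynomial (Fin d) ℂ}
    (hp : p ∈ solidHarmonics d k) (i : Fin d) : pderiv i p ∈ solidHarmonics d (k - 1) := by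
  rw [mem_solidHarmonics] at hp ⊢
  refine ⟨hp.1.pderiv, ?_⟩
  have comm : ∀ (j : Fin d) (q : MvPolynomial (Fin d) ℂ),
      pderiv j (pderiv i q) = pderiv i (pderiv j q) := by
    intro j q
    -- The commutator of two derivations is a derivation, so it suffices to test it on the
    -- variables.
    have : ⁅pderiv (R := ℂ) j, pderiv (R := ℂ) i⁆ = 0 := by
      refine derivation_ext fun l => ?_
      classical
      simp only [Derivation.commutator_apply, pderiv_X, Pi.single_apply, Derivation.coe_zero,
        Pi.zero_apply]
      split_ifs <;> simp
    have h := congrArg (fun D => D q) this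
    simpa [Derivation.commutator_apply, sub_eq_zero] using h
  rw [laplacian_apply] at hp ⊢
  simp only [comm]
  rw [← map_sum, hp.2, map_zero]

end FKT

/-! ### Gaussian integrals of polynomials and orthogonality of harmonics -/

namespace FKT

open MvPolynomial MeasureTheory

variable {d : ℕ}

/-- The value of a complex polynomial at a point of `ℝᵈ`. -/
def evalAt (x : E d) : MvPolynomial (Fin d) ℂ →+* ℂ := eval fun i => ((x i : ℝ) : ℂ)

@[simp] lemma evalAt_X (x : E d) (i : Fin d) : evalAt x (X i) = (x i : ℂ) := by simp [evalAt]

@[simp] lemma evalAt_C (x : E d) (c : ℂ) : evalAt x (C c) = c := by simp [evalAt]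

@[simp] lemma evalAt_smul (x : E d) (c : ℂ) (p : MvPolynomial (Fin d) ℂ) :
    evalAt x (c • p) = c * evalAt x p := by simp [evalAt]

lemma evalAt_real_smul {m : ℕ} {p : MvPolynomial (Fin d) ℂ} (hp : p.IsHomogeneous m) (r : ℝ)
    (x : E d) : evalAt (r • x) p = (r : ℂ) ^ m * evalAt x p := by
  simp only [evalAt, eval_eq, Finset.mul_sum]
  refine Finset.sum_congr rfl fun n hn => ?_
  have : ∑ i ∈ n.support, n i = m := (hp.degree_eq_sum_deg_support hn).symm
  simp only [PiLp.smul_apply, smul_eq_mul, Complex.ofReal_mul, mul_pow, Finset.prod_mul_distrib,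
    Finset.prod_pow_eq_pow_sum, this]
  ring

lemma evalAt_map_conj (x : E d) (p : MvPolynomial (Fin d) ℂ) :
    evalAt x (map (starRingEnd ℂ) p) = starRingEnd ℂ (evalAt x p) := by
  induction p using MvPolynomial.induction_on with
  | C c => simp
  | add p q hp hq => simp [hp, hq]
  | mul_X p j hp => simp [hp]

lemma continuous_evalAt (p : MvPolynomial (Fin d) ℂ) : Continuous fun x : E d => evalAt x p := by
  simp only [evalAt, eval_eq]
  fun_prop

lemma evalAt_normSqPoly (x : E d) : evalAt x (normSqPoly d) = (‖x‖ : ℂ) ^ 2 := by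
  rw [normSqPoly, map_sum, ← Complex.ofReal_pow, EuclideanSpace.real_norm_sq_eq]
  simp

/-- The coordinate `x ↦ xᵢ` as a complex-valued functional. -/
def coordCLM (i : Fin d) : E d →L[ℝ] ℂ := Complex.ofRealCLM.comp (EuclideanSpace.proj i)

@[simp] lemma coordCLM_apply (i : Fin d) (x : E d) : coordCLM i x = (x i : ℂ) := rfl

lemma hasFDerivAt_evalAt (p : MvPolynomial (Fin d) ℂ) (x : E d) :
    HasFDerivAt (fun x : E d => evalAt x p)
      (∑ i, evalAt x (pderiv i p) •
        coordCLM i) x := by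
  induction p using MvPolynomial.induction_on with
  | C c =>
    simp only [evalAt_C]
    refine (hasFDerivAt_const (𝕜 := ℝ) c x).congr_fderiv ?_
    ext v
    simp
  | add p q hp hq =>
    simp only [map_add]
    refine (hp.add hq).congr_fderiv ?_
    ext v
    simp [add_mul, Finset.sum_add_distrib]
  | mul_X p j hp =>
    have hj : HasFDerivAt (fun x : E d => ((x j : ℝ) : ℂ)) (coordCLM j) x :=
      (coordCLM j).hasFDerivAt
    simp only [map_mul, evalAt_X]
    refine (hp.mul hj).congr_fderiv ?_
    ext v
    have h : ∀ i, evalAt x (pderiv i (X j)) * (v i : ℂ) = if i = j then (v j : ℂ) else 0 := by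
      intro i
      split_ifs with hi
      · simp [hi]
      · simp [pderiv_X_of_ne (Ne.symm hi)]
    simp only [pderiv_mul, map_add, map_mul, evalAt_X, add_apply, smul_apply, sum_apply,
      coordCLM_apply, smul_eq_mul, add_mul, mul_assoc, h, Finset.sum_add_distrib, mul_ite,
      mul_zero, Finset.sum_ite_eq', Finset.mem_univ, if_true, Finset.mul_sum]
    rw [add_comm]
    congr 1
    refine Finset.sum_congr rfl fun i _ => ?_
    ring

/-- The rate `a` stays quantified through the induction because multiplication by a coordinate
spends half of it. -/
lemma exists_norm_evalAt_le (p : MvPolynomial (Fin d) ℂ) :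
    ∀ {a : ℝ}, 0 < a → ∃ c, ∀ x : E d, ‖evalAt x p‖ ≤ c * Real.exp (a * ‖x‖ ^ 2) := by
  induction p using MvPolynomial.induction_on with
  | C z =>
    refine fun {a} ha => ⟨‖z‖, fun x => ?_⟩
    rw [evalAt_C]
    exact le_mul_of_one_le_right (norm_nonneg _) (Real.one_le_exp (by positivity))
  | add p q hp hq =>
    intro a ha
    obtain ⟨c, hc⟩ := hp ha
    obtain ⟨c', hc'⟩ := hq ha
    refine ⟨c + c', fun x => ?_⟩
    rw [map_add, add_mul]
    exact (norm_add_le _ _).trans (add_le_add (hc x) (hc' x))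
  | mul_X p j hp =>
    intro a ha
    obtain ⟨c, hc⟩ := hp (half_pos ha)
    refine ⟨c * (1 + 2 / a), fun x => ?_⟩
    have h1 : ‖((x j : ℝ) : ℂ)‖ ≤ (1 + 2 / a) * Real.exp (a / 2 * ‖x‖ ^ 2) := by
      rw [Complex.norm_real]
      calc ‖x j‖ ≤ ‖x‖ := PiLp.norm_apply_le x j
        _ ≤ 1 + ‖x‖ ^ 2 := by nlinarith [sq_nonneg (‖x‖ - 1)]
        _ ≤ (1 + 2 / a) * (a / 2 * ‖x‖ ^ 2 + 1) := by
          have : (1 + 2 / a) * (a / 2 * ‖x‖ ^ 2 + 1) =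
            1 + ‖x‖ ^ 2 + (a / 2 * ‖x‖ ^ 2 + 2 / a) := by field_simp; ring
          rw [this]
          have : 0 ≤ a / 2 * ‖x‖ ^ 2 + 2 / a := by positivity
          linarith
        _ ≤ _ := by gcongr; exact Real.add_one_le_exp _
    rw [map_mul, evalAt_X, norm_mul]
    calc _ ≤ (c * Real.exp (a / 2 * ‖x‖ ^ 2)) * ((1 + 2 / a) * Real.exp (a / 2 * ‖x‖ ^ 2)) :=
          mul_le_mul (hc x) h1 (norm_nonneg _) ((norm_nonneg _).trans (hc x))
      _ = _ := by
        rw [show a * ‖x‖ ^ 2 = a / 2 * ‖x‖ ^ 2 + a / 2 * ‖x‖ ^ 2 by ring, Real.exp_add]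
        ring

/-- The Gaussian `exp (-|x|² / 2)`. -/
def gaussian (x : E d) : ℂ := Complex.exp (-(1 / 2) * (‖x‖ : ℂ) ^ 2)

lemma gaussian_eq (x : E d) : gaussian x = (Real.exp (-(1 / 2) * ‖x‖ ^ 2) : ℝ) := by
  simp [gaussian]

lemma gaussian_eq_evalAt (x : E d) :
    gaussian x = Complex.exp (-(1 / 2) * evalAt x (normSqPoly d)) := by
  rw [gaussian, evalAt_normSqPoly]

lemma continuous_gaussian : Continuous (gaussian : E d → ℂ) := by
  unfold gaussian; fun_prop

lemma integrable_evalAt_mul_gaussian (p : MvPolynomial (Fin d) ℂ) :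
    Integrable fun x : E d => evalAt x p * gaussian x := by
  obtain ⟨c, hc⟩ := exists_norm_evalAt_le p (a := 1 / 4) (by norm_num)
  have h := (GaussianFourier.integrable_cexp_neg_mul_sq_norm_add (V := E d) (b := 1 / 4)
    (by norm_num) 0 0).norm.const_mul c
  refine h.mono' ((continuous_evalAt p).mul continuous_gaussian).aestronglyMeasurable ?_
  refine Filter.Eventually.of_forall fun x => ?_
  have e1 : ‖Complex.exp (-(1 / 4) * (‖x‖ : ℂ) ^ 2 + 0 * ((inner ℝ (0 : E d) x : ℝ) : ℂ))‖ =
      Real.exp (1 / 4 * ‖x‖ ^ 2) * Real.exp (-(1 / 2) * ‖x‖ ^ 2) := by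
    rw [← Real.exp_add, Complex.norm_exp]
    congr 1
    have : (-(1 / 4) * (‖x‖ : ℂ) ^ 2 + 0 * ((inner ℝ (0 : E d) x : ℝ) : ℂ)) =
      ((-(1 / 4) * ‖x‖ ^ 2 : ℝ) : ℂ) := by push_cast; ring
    rw [this, Complex.ofReal_re]
    ring
  rw [norm_mul, e1, gaussian_eq, Complex.norm_real, Real.norm_of_nonneg (Real.exp_pos _).le,
    ← mul_assoc]
  exact mul_le_mul_of_nonneg_right (hc x) (Real.exp_pos _).le

/-- The integral of a polynomial against the Gaussian `exp (-|x|² / 2)`. -/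
def gaussInt (d : ℕ) : MvPolynomial (Fin d) ℂ →ₗ[ℂ] ℂ where
  toFun p := ∫ x : E d, evalAt x p * gaussian x
  map_add' p q := by
    simp only [map_add, add_mul]
    exact integral_add (integrable_evalAt_mul_gaussian p) (integrable_evalAt_mul_gaussian q)
  map_smul' c p := by
    simp only [evalAt_smul, mul_assoc, RingHom.id_apply, smul_eq_mul]
    exact integral_const_mul c _

lemma gaussInt_apply (p : MvPolynomial (Fin d) ℂ) :
    gaussInt d p = ∫ x : E d, evalAt x p * gaussian x := rfl

lemma hasFDerivAt_gaussian (x : E d) :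
    HasFDerivAt (gaussian : E d → ℂ) (∑ i, (-((x i : ℝ) : ℂ) * gaussian x) •
        coordCLM i) x := by
  have h := ((hasFDerivAt_evalAt (normSqPoly d) x).const_mul (-(1 / 2) : ℂ)).cexp
  have e : (gaussian : E d → ℂ) =
      fun x => Complex.exp (-(1 / 2) * evalAt x (normSqPoly d)) := funext gaussian_eq_evalAt
  rw [gaussian_eq_evalAt, e]
  refine h.congr_fderiv ?_
  simp only [pderiv_normSqPoly, map_mul, map_ofNat, evalAt_X, Finset.smul_sum, smul_smul]
  refine Finset.sum_congr rfl fun i _ => ?_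
  congr 1
  ring

/-- Integration by parts for the Gaussian functional. -/
lemma gaussInt_X_mul (i : Fin d) (p : MvPolynomial (Fin d) ℂ) :
    gaussInt d (X i * p) = gaussInt d (pderiv i p) := by
  have happ : ∀ (c : Fin d → ℂ), (∑ j, c j • coordCLM j)
      (EuclideanSpace.single i (1 : ℝ)) = c i := by
    intro c
    simp [apply_ite]
  have h1 : ∀ x : E d, fderiv ℝ (fun x : E d => evalAt x p) x (EuclideanSpace.single i (1 : ℝ)) =
      evalAt x (pderiv i p) := fun x => by rw [(hasFDerivAt_evalAt p x).fderiv, happ]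
  have h2 : ∀ x : E d, fderiv ℝ (gaussian : E d → ℂ) x (EuclideanSpace.single i (1 : ℝ)) =
      -((x i : ℝ) : ℂ) * gaussian x := fun x => by rw [(hasFDerivAt_gaussian x).fderiv, happ]
  have h := integral_mul_fderiv_eq_neg_fderiv_mul_of_integrable (𝕜 := ℂ) (μ := volume)
    (f := fun x : E d => evalAt x p) (g := gaussian) (v := EuclideanSpace.single i (1 : ℝ))
    (by simpa only [h1] using integrable_evalAt_mul_gaussian (pderiv i p))
    (by
      simp only [h2]
      refine (integrable_evalAt_mul_gaussian (X i * p)).neg.congr ?_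
      refine Filter.Eventually.of_forall fun x => ?_
      simp only [Pi.neg_apply, map_mul, evalAt_X]
      ring)
    (integrable_evalAt_mul_gaussian p)
    (fun x _ => (hasFDerivAt_evalAt p x).differentiableAt)
    (fun x _ => (hasFDerivAt_gaussian x).differentiableAt)
  simp only [h1, h2] at h
  rw [gaussInt_apply, gaussInt_apply, ← neg_inj, ← h, ← integral_neg]
  congr 1
  ext x
  simp only [map_mul, evalAt_X]
  ring

/-- Euler's identity writes m q as ∑ Xᵢ ∂ᵢq; integration by parts then removes each Xᵢ. -/
lemma natCast_mul_gaussInt {m : ℕ} {q : MvPolynomial (Fin d) ℂ} (hq : q.IsHomogeneous m)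
    (p : MvPolynomial (Fin d) ℂ) :
    (m : ℂ) * gaussInt d (p * q) =
      gaussInt d (∑ i, pderiv i p * pderiv i q) + gaussInt d (p * laplacian d q) := by
  have h : (m : ℂ) • (p * q) = ∑ i, X i * (p * pderiv i q) := by
    rw [← mul_smul_comm, Nat.cast_smul_eq_nsmul, ← hq.sum_X_mul_pderiv, Finset.mul_sum]
    exact Finset.sum_congr rfl fun i _ => by ring
  rw [← smul_eq_mul, ← map_smul, h, map_sum, laplacian_apply, Finset.mul_sum, ← map_add,
    ← Finset.sum_add_distrib, map_sum]
  refine Finset.sum_congr rfl fun i _ => ?_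
  rw [gaussInt_X_mul, pderiv_mul]

/-- For harmonic p and q, both k and l times the integral equal the symmetric Dirichlet form ∑ ∂ᵢp
∂ᵢq. -/
lemma gaussInt_mul_eq_zero {k l : ℕ} (hkl : k ≠ l) {p q : MvPolynomial (Fin d) ℂ}
    (hp : p ∈ solidHarmonics d k) (hq : q ∈ solidHarmonics d l) : gaussInt d (p * q) = 0 := by
  rw [mem_solidHarmonics] at hp hq
  have h1 := natCast_mul_gaussInt hq.1 p
  have h2 := natCast_mul_gaussInt hp.1 q
  rw [hq.2, mul_zero, map_zero, add_zero] at h1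
  rw [hp.2, mul_zero, map_zero, add_zero, mul_comm q p] at h2
  have h3 : (k : ℂ) * gaussInt d (p * q) = l * gaussInt d (p * q) := by
    rw [h1, h2]
    congr 1
    exact Finset.sum_congr rfl fun i _ => mul_comm _ _
  by_contra h0
  exact hkl (Nat.cast_injective (mul_right_cancel₀ h0 h3))

end FKT

/-! ### From the Gaussian to the sphere; Funk–Hecke for powers -/

namespace FKT

open MvPolynomial MeasureTheory

variable {d : ℕ}

/-- The surface measure of the unit sphere. -/
abbrev sphereMeasure (d : ℕ) : Measure (Metric.sphere (0 : E d) 1) :=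
  (volume : Measure (E d)).toSphere

/-- The moment `∫₀^∞ r^(m + d - 1) exp (-r² / 2) dr`. -/
def radialMoment (d m : ℕ) : ℝ :=
  ∫ r in Set.Ioi (0 : ℝ), r ^ (d - 1) * (r ^ m * Real.exp (-(1 / 2) * r ^ 2))

lemma radialMoment_eq (hd : 0 < d) (m : ℕ) :
    radialMoment d m = (1 / 2 : ℝ) ^ (-((m + d : ℝ) / 2)) * (1 / 2) * Real.Gamma ((m + d) / 2) := by
  have h := integral_rpow_mul_exp_neg_mul_rpow (p := 2) (q := m + d - 1) (b := 1 / 2)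
    (by norm_num) (by
      have : (1 : ℝ) ≤ d := by exact_mod_cast hd
      have : (0 : ℝ) ≤ m := by positivity
      linarith) (by norm_num)
  rw [sub_add_cancel] at h
  rw [neg_div] at h
  rw [radialMoment, ← h]
  refine setIntegral_congr_fun measurableSet_Ioi fun r hr => ?_
  have hr : 0 < r := hr
  rw [← mul_assoc, ← pow_add, ← Real.rpow_natCast r (d - 1 + m), Real.rpow_two]
  congr 2
  push_cast [Nat.cast_sub hd]
  ring

lemma radialMoment_pos (hd : 0 < d) (m : ℕ) : 0 < radialMoment d m := by
  rw [radialMoment_eq hd]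
  have : 0 < Real.Gamma ((m + d : ℝ) / 2) := Real.Gamma_pos_of_pos (by positivity)
  positivity

/-- These moment ratios are the source of the Pochhammer symbol in `ZA`. -/
lemma radialMoment_two_mul (hd : 0 < d) (a : ℕ) :
    radialMoment d (2 * a) =
      2 ^ a * (ascPochhammer ℝ a).eval ((d : ℝ) / 2) * radialMoment d 0 := by
  induction a with
  | zero => simp
  | succ a ih =>
    have h : radialMoment d (2 * (a + 1)) = 2 * ((d : ℝ) / 2 + a) * radialMoment d (2 * a) := by
      rw [radialMoment_eq hd, radialMoment_eq hd]
      have e : (((2 * (a + 1) : ℕ) : ℝ) + d) / 2 = ((2 * a : ℕ) + d : ℝ) / 2 + 1 := by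
        push_cast; ring
      rw [e, Real.Gamma_add_one (by positivity), neg_add, Real.rpow_add (by norm_num),
        Real.rpow_neg_one]
      push_cast
      field_simp
      ring
    rw [h, ih, ascPochhammer_succ_eval, pow_succ]
    ring

/-- Polar coordinates: homogeneity separates the integrand into an angular and a radial factor. -/
lemma gaussInt_eq_mul_integral_sphere (hd : 0 < d) {m : ℕ} {p : MvPolynomial (Fin d) ℂ}
    (hp : p.IsHomogeneous m) :
    gaussInt d p = (∫ ω, evalAt (ω : E d) p ∂sphereMeasure d) * radialMoment d m := by
  have : Nonempty (Fin d) := ⟨⟨0, hd⟩⟩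
  have : Nontrivial (E d) := inferInstance
  have hpt : ∀ z : ({(0)}ᶜ : Set (E d)), evalAt (z : E d) p * gaussian (z : E d) =
      (fun y : Metric.sphere (0 : E d) 1 × Set.Ioi (0 : ℝ) => evalAt (y.1 : E d) p *
        (((y.2 : ℝ) ^ m * Real.exp (-(1 / 2) * (y.2 : ℝ) ^ 2) : ℝ) : ℂ))
        (homeomorphUnitSphereProd (E d) z) := by
    rintro ⟨z, hz⟩
    have hz : z ≠ 0 := hz
    have hz' : ‖z‖ ≠ 0 := norm_ne_zero_iff.2 hz
    simp only [homeomorphUnitSphereProd_apply_fst_coe, homeomorphUnitSphereProd_apply_snd_coe]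
    rw [evalAt_real_smul hp, gaussian_eq]
    push_cast
    have : (‖z‖ : ℂ) ≠ 0 := by exact_mod_cast hz'
    rw [inv_pow]
    field_simp
  calc
    gaussInt d p = ∫ z : ({(0)}ᶜ : Set (E d)), evalAt (z : E d) p * gaussian (z : E d)
        ∂((volume : Measure (E d)).comap Subtype.val) := by
      rw [integral_subtype_comap (measurableSet_singleton _).compl
        fun z : E d => evalAt z p * gaussian z, restrict_compl_singleton, gaussInt_apply]
    _ = ∫ y, evalAt (y.1 : E d) p *
        (((y.2 : ℝ) ^ m * Real.exp (-(1 / 2) * (y.2 : ℝ) ^ 2) : ℝ) : ℂ)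
        ∂((sphereMeasure d).prod (Measure.volumeIoiPow (Module.finrank ℝ (E d) - 1))) := by
      rw [← (volume : Measure (E d)).measurePreserving_homeomorphUnitSphereProd.integral_comp
        (Homeomorph.measurableEmbedding _)]
      exact integral_congr_ae (Filter.Eventually.of_forall hpt)
    _ = (∫ ω, evalAt (ω : E d) p ∂sphereMeasure d) *
        ∫ r : Set.Ioi (0 : ℝ), (((r : ℝ) ^ m * Real.exp (-(1 / 2) * (r : ℝ) ^ 2) : ℝ) : ℂ)
        ∂(Measure.volumeIoiPow (Module.finrank ℝ (E d) - 1)) :=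
      integral_prod_mul (fun ω : Metric.sphere (0 : E d) 1 => evalAt (ω : E d) p)
        fun r : Set.Ioi (0 : ℝ) => (((r : ℝ) ^ m * Real.exp (-(1 / 2) * (r : ℝ) ^ 2) : ℝ) : ℂ)
    _ = _ := by
      rw [integral_complex_ofReal, radialMoment]
      congr 2
      simp only [Measure.volumeIoiPow, ENNReal.ofReal, finrank_euclideanSpace_fin]
      rw [integral_withDensity_eq_integral_smul,
        integral_subtype_comap measurableSet_Ioi fun a : ℝ =>
          Real.toNNReal (a ^ (d - 1)) • (a ^ m * Real.exp (-(1 / 2) * a ^ 2)),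
        setIntegral_congr_fun measurableSet_Ioi fun x hx ↦ ?_]
      · rw [NNReal.smul_def, Real.coe_toNNReal _ (pow_nonneg hx.out.le _), smul_eq_mul]
      · exact (measurable_subtype_coe.pow_const _).real_toNNReal

lemma gaussInt_one_eq (hd : 0 < d) : gaussInt d 1 = (sphereArea d * radialMoment d 0 : ℝ) := by
  have h : gaussInt d 1 = (2 * Real.pi : ℂ) ^ ((d : ℂ) / 2) := by
    have := GaussianFourier.integral_cexp_neg_mul_sq_norm (V := E d) (b := 1 / 2) (by norm_num)
    rw [finrank_euclideanSpace_fin] at this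
    simp only [gaussInt_apply, map_one, one_mul, gaussian]
    rw [this]
    congr 1
    ring
  have e : (2 * Real.pi : ℂ) ^ ((d : ℂ) / 2) = (((2 * Real.pi) ^ ((d : ℝ) / 2) : ℝ) : ℂ) := by
    rw [Complex.ofReal_cpow (by positivity)]
    push_cast
    rfl
  rw [h, e, Complex.ofReal_inj, radialMoment_eq hd, sphereArea, Nat.cast_zero, zero_add,
    Real.mul_rpow (by norm_num) (by positivity), one_div, Real.inv_rpow (by norm_num),
    Real.rpow_neg (by norm_num), inv_inv]
  have : Real.Gamma ((d : ℝ) / 2) ≠ 0 := (Real.Gamma_pos_of_pos (by positivity)).ne'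
  field_simp

lemma integral_sphere_mul_eq_zero (hd : 0 < d) {k l : ℕ} (hkl : k ≠ l)
    {p q : MvPolynomial (Fin d) ℂ} (hp : p ∈ solidHarmonics d k) (hq : q ∈ solidHarmonics d l) :
    ∫ ω, evalAt (ω : E d) (p * q) ∂sphereMeasure d = 0 := by
  have h := gaussInt_eq_mul_integral_sphere hd (hp.1.mul hq.1)
  rw [gaussInt_mul_eq_zero hkl hp hq] at h
  have h0 : (radialMoment d (k + l) : ℂ) ≠ 0 :=
    Complex.ofReal_ne_zero.2 (radialMoment_pos hd _).ne'
  exact (mul_eq_zero.1 h.symm).resolve_right h0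

/-- The linear form `x ↦ x ⬝ y`. -/
def linForm (y : E d) : MvPolynomial (Fin d) ℂ := ∑ i, C ((y i : ℝ) : ℂ) * X i

lemma isHomogeneous_linForm (y : E d) : (linForm y).IsHomogeneous 1 :=
  IsHomogeneous.sum _ _ _ fun i _ => isHomogeneous_C_mul_X _ i

lemma evalAt_linForm (x y : E d) : evalAt x (linForm y) = (inner ℝ x y : ℝ) := by
  simp [linForm, PiLp.inner_apply]

/-- The derivative in the direction `y`. -/
def dirDeriv (y : E d) (p : MvPolynomial (Fin d) ℂ) : MvPolynomial (Fin d) ℂ :=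
  ∑ i, ((y i : ℝ) : ℂ) • pderiv i p

lemma gaussInt_linForm_mul (y : E d) (p : MvPolynomial (Fin d) ℂ) :
    gaussInt d (linForm y * p) = gaussInt d (dirDeriv y p) := by
  rw [linForm, dirDeriv, Finset.sum_mul, map_sum, map_sum]
  refine Finset.sum_congr rfl fun i _ => ?_
  rw [mul_assoc, ← smul_eq_C_mul, map_smul, map_smul, gaussInt_X_mul]

lemma dirDeriv_linForm_pow_mul {y : E d} (hy : ‖y‖ = 1) (i : ℕ) (p : MvPolynomial (Fin d) ℂ) :
    dirDeriv y (linForm y ^ i * p) =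
      (i : ℂ) • (linForm y ^ (i - 1) * p) + linForm y ^ i * dirDeriv y p := by
  have h1 : ∀ j, pderiv j (linForm y) = C ((y j : ℝ) : ℂ) := by
    intro j
    rw [linForm, map_sum, Finset.sum_eq_single j]
    · simp
    · intro l _ hl
      rw [pderiv_C_mul, pderiv_X_of_ne hl, mul_zero]
    · simp
  have h2 : ∑ j, ((y j : ℝ) : ℂ) * ((y j : ℝ) : ℂ) = 1 := by
    have := EuclideanSpace.real_norm_sq_eq y
    rw [hy, one_pow] at this
    have := congrArg (fun t : ℝ => (t : ℂ)) this
    simpa [sq] using this.symm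
  have h3 : ∀ j, ((y j : ℝ) : ℂ) • pderiv j (linForm y ^ i * p) =
      C (((y j : ℝ) : ℂ) * ((y j : ℝ) : ℂ)) * ((i : ℂ) • (linForm y ^ (i - 1) * p)) +
        linForm y ^ i * (((y j : ℝ) : ℂ) • pderiv j p) := by
    intro j
    simp only [pderiv_mul, pderiv_pow, h1, smul_eq_C_mul, map_mul, map_natCast]
    ring
  rw [dirDeriv, Finset.sum_congr rfl fun j _ => h3 j, Finset.sum_add_distrib, ← Finset.sum_mul,
    ← map_sum, h2, map_one, one_mul, dirDeriv, Finset.mul_sum]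

lemma dirDeriv_mem_solidHarmonics (y : E d) {k : ℕ} {p : MvPolynomial (Fin d) ℂ}
    (hp : p ∈ solidHarmonics d k) : dirDeriv y p ∈ solidHarmonics d (k - 1) :=
  Submodule.sum_mem _ fun i _ => Submodule.smul_mem _ _ (pderiv_mem_solidHarmonics hp i)

lemma evalAt_dirDeriv_self (y : E d) {k : ℕ} {p : MvPolynomial (Fin d) ℂ}
    (hp : p.IsHomogeneous k) : evalAt y (dirDeriv y p) = k * evalAt y p := by
  have := congrArg (evalAt y) hp.sum_X_mul_pderiv
  simpa only [dirDeriv, map_sum, evalAt_smul, map_mul, evalAt_X, map_nsmul,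
    nsmul_eq_mul, map_natCast] using this

/-- The Gaussian moment of `(x ⬝ y)ⁱ` against a solid harmonic of degree `k` is this multiple of
its value at the unit vector `y`. -/
def gaussCoeff (k i : ℕ) : ℚ :=
  if k ≤ i ∧ Even (i - k) then (i ! : ℚ) / (2 ^ ((i - k) / 2) * ((i - k) / 2)!) else 0

lemma gaussCoeff_zero_right (k : ℕ) : gaussCoeff k 0 = if k = 0 then 1 else 0 := by
  by_cases h : k = 0 <;> simp [gaussCoeff, h]

lemma gaussCoeff_add_two_mul (k a : ℕ) :
    gaussCoeff k (k + 2 * a) = (k + 2 * a)! / (2 ^ a * a !) := by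
  simp [gaussCoeff]

lemma gaussCoeff_eq_zero {k i : ℕ} (h : ∀ a, i ≠ k + 2 * a) : gaussCoeff k i = 0 := by
  rw [gaussCoeff, if_neg]
  rintro ⟨h1, a, ha⟩
  exact h a (by omega)

/-- This mirrors one integration by parts: the derivative falls on one of the i remaining linear
factors, or on the harmonic, lowering its degree. The truncated i - 1 and k - 1 are harmless, being
multiplied by 0 at i = 0 and k = 0. -/
lemma gaussCoeff_succ (k i : ℕ) :
    gaussCoeff k (i + 1) = i * gaussCoeff k (i - 1) + k * gaussCoeff (k - 1) i := by
  by_cases h : ∃ a, i + 1 = k + 2 * a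
  · obtain ⟨a, ha⟩ := h
    rw [ha, gaussCoeff_add_two_mul]
    have hf : ((k + 2 * a)! : ℚ) = (k + 2 * a) * i ! := by
      rw [← ha, Nat.factorial_succ, ha]
      push_cast
      ring
    have hk : (k : ℚ) * gaussCoeff (k - 1) i = k * (i ! / (2 ^ a * a !)) := by
      rcases k with _ | k
      · simp
      · obtain rfl : i = k + 2 * a := by omega
        rw [Nat.add_sub_cancel, gaussCoeff_add_two_mul]
    have hi : (i : ℚ) * gaussCoeff k (i - 1) = 2 * a * (i ! / (2 ^ a * a !)) := by
      rcases a with _ | a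
      · rcases i with _ | i
        · simp
        · rw [gaussCoeff_eq_zero (fun a => by omega)]
          simp
      · obtain rfl : i = k + 2 * a + 1 := by omega
        rw [Nat.add_sub_cancel, gaussCoeff_add_two_mul, Nat.factorial_succ (k + 2 * a),
          Nat.factorial_succ a]
        push_cast
        field_simp
        ring
    rw [hk, hi, hf]
    ring
  · push Not at h
    rw [gaussCoeff_eq_zero h]
    have hk : (k : ℚ) * gaussCoeff (k - 1) i = 0 := by
      rcases k with _ | k
      · simp
      · rw [gaussCoeff_eq_zero (fun a => by have := h a; omega), mul_zero]
    have hi : (i : ℚ) * gaussCoeff k (i - 1) = 0 := by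
      rcases i with _ | i
      · simp
      · rw [gaussCoeff_eq_zero (fun a => by have := h (a + 1); omega), mul_zero]
    rw [hk, hi, add_zero]

lemma gaussInt_eq_zero_of_mem_solidHarmonics {k : ℕ} (hk : k ≠ 0) {p : MvPolynomial (Fin d) ℂ}
    (hp : p ∈ solidHarmonics d k) : gaussInt d p = 0 := by
  have h1 : (1 : MvPolynomial (Fin d) ℂ) ∈ solidHarmonics d 0 :=
    mem_solidHarmonics.2 ⟨isHomogeneous_one _ _, laplacian_eq_zero (by norm_num)
      (isHomogeneous_one _ _)⟩
  simpa using gaussInt_mul_eq_zero hk hp h1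

lemma gaussInt_linForm_pow_mul {y : E d} (hy : ‖y‖ = 1) (i : ℕ) :
    ∀ {k : ℕ} {p : MvPolynomial (Fin d) ℂ}, p ∈ solidHarmonics d k →
      gaussInt d (linForm y ^ i * p) = gaussCoeff k i * evalAt y p * gaussInt d 1 := by
  induction i using Nat.strong_induction_on with
  | _ i ih =>
    intro k p hp
    rcases i with _ | i
    · rw [pow_zero, one_mul, gaussCoeff_zero_right]
      split_ifs with hk
      · subst hk
        rw [totalDegree_eq_zero_iff_eq_C.1 ((totalDegree_zero_iff_isHomogeneous _).2 hp.1),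
          evalAt_C, ← mul_one (C _), ← smul_eq_C_mul, map_smul]
        simp
      · rw [gaussInt_eq_zero_of_mem_solidHarmonics hk hp]
        simp
    · rw [pow_succ', mul_assoc, gaussInt_linForm_mul, dirDeriv_linForm_pow_mul hy, map_add,
        map_smul, ih (i - 1) (by omega) hp, ih i (by omega) (dirDeriv_mem_solidHarmonics y hp),
        evalAt_dirDeriv_self y hp.1, gaussCoeff_succ, smul_eq_mul]
      push_cast
      ring

/-- The Funk–Hecke formula for powers. -/
theorem integral_sphere_linForm_pow_mul (hd : 0 < d) {y : E d} (hy : ‖y‖ = 1) (i : ℕ) {k : ℕ}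
    {p : MvPolynomial (Fin d) ℂ} (hp : p ∈ solidHarmonics d k) :
    ∫ ω, evalAt (ω : E d) (linForm y ^ i * p) ∂sphereMeasure d = ZA d k i * evalAt y p := by
  have h := gaussInt_eq_mul_integral_sphere hd (((isHomogeneous_linForm y).pow i).mul hp.1)
  rw [gaussInt_linForm_pow_mul hy i hp, gaussInt_one_eq hd, one_mul] at h
  have h0 : (radialMoment d (i + k) : ℂ) ≠ 0 :=
    Complex.ofReal_ne_zero.2 (radialMoment_pos hd _).ne'
  refine mul_right_cancel₀ h0 (h.symm.trans ?_)
  -- The Gaussian coefficient becomes the spherical one on division by the radial moment of degree i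
  -- + k.
  have key : (gaussCoeff k i : ℝ) * (sphereArea d * radialMoment d 0) =
      ZA d k i * radialMoment d (i + k) := by
    by_cases hki : k ≤ i ∧ Even (i - k)
    · obtain ⟨hk, a, ha⟩ := hki
      obtain rfl : i = k + 2 * a := by omega
      rw [gaussCoeff_add_two_mul, ZA, if_pos ⟨hk, a, ha⟩,
        show k + 2 * a + k = 2 * (k + a) by ring, radialMoment_two_mul hd,
        show (k + 2 * a - k) / 2 = a by omega, show 2 * (k + a) / 2 = k + a by omega]
      have : (ascPochhammer ℝ (k + a)).eval ((d : ℝ) / 2) ≠ 0 :=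
        (ascPochhammer_pos _ _ (by positivity)).ne'
      have h2 : (2 : ℝ) ^ (k + 2 * a) = 2 ^ (k + a) * 2 ^ a := by rw [← pow_add]; congr 1; ring
      rw [h2]
      push_cast
      field_simp
    · rw [gaussCoeff, if_neg hki, ZA, if_neg hki]
      simp
  have key' := congrArg (fun t : ℝ => (t : ℂ)) key
  push_cast at key' ⊢
  linear_combination (evalAt y p) * key'

end FKT

/-! ### Expansion of powers of the inner product in harmonics, with bounds -/

namespace FKT

open MvPolynomial MeasureTheory

variable {d : ℕ}

lemma integrable_evalAt_sphere (p : MvPolynomial (Fin d) ℂ) :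
    Integrable (fun ω : Metric.sphere (0 : E d) 1 => evalAt (ω : E d) p) (sphereMeasure d) :=
  ((continuous_evalAt p).comp continuous_subtype_val).integrable_of_hasCompactSupport
    (HasCompactSupport.of_compactSpace _)

lemma angularPart_apply_of_norm_eq_one (p : MvPolynomial (Fin d) ℂ) {x : E d} (hx : ‖x‖ = 1) :
    angularPart d p x = evalAt x p := by
  change evalAt (‖x‖⁻¹ • x) p = _
  rw [hx, inv_one, one_smul]

/-- On the unit sphere, homogeneous polynomials are sums of harmonics. -/
lemma exists_eq_sum_solidHarmonics {n : ℕ} {f : MvPolynomial (Fin d) ℂ}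
    (hf : f ∈ harmonicSpan d n) :
    ∃ q : ℕ → MvPolynomial (Fin d) ℂ, (∀ k, q k ∈ solidHarmonics d k) ∧
      ∀ x : E d, ‖x‖ = 1 → evalAt x f = ∑ k ∈ Finset.range (n + 1), evalAt x (q k) := by
  induction hf using Submodule.span_induction with
  | mem f hf =>
    obtain ⟨j, m, rfl, h, hh, rfl⟩ := hf
    refine ⟨Pi.single m h, fun k => ?_, fun x hx => ?_⟩
    · by_cases hk : k = m
      · subst hk; simpa using hh
      · simp [hk]
    · rw [Finset.sum_eq_single m]
      · simp [evalAt_normSqPoly, hx]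
      · intro k _ hk
        simp [hk]
      · intro hm
        exact absurd (Finset.mem_range.2 (by omega)) hm
  | zero => exact ⟨0, fun k => Submodule.zero_mem _, fun x _ => by simp⟩
  | add f g _ _ hf hg =>
    obtain ⟨p, hp, hp'⟩ := hf
    obtain ⟨q, hq, hq'⟩ := hg
    refine ⟨p + q, fun k => Submodule.add_mem _ (hp k) (hq k), fun x hx => ?_⟩
    simp [hp' x hx, hq' x hx, Finset.sum_add_distrib]
  | smul c f _ hf =>
    obtain ⟨p, hp, hp'⟩ := hf
    refine ⟨c • p, fun k => Submodule.smul_mem _ _ (hp k), fun x hx => ?_⟩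
    simp [hp' x hx, Finset.mul_sum]

namespace IsHarmonicBasis

variable {k : ℕ} {ι : Type*} {Y : ι → E d → ℂ}

lemma exists_solidHarmonic (hY : IsHarmonicBasis d k Y) (h : ι) :
    ∃ p ∈ solidHarmonics d k, angularPart d p = Y h := by
  have : Y h ∈ hypersphericalHarmonics d k :=
    hY.span_eq ▸ Submodule.subset_span (Set.mem_range_self h)
  simpa [hypersphericalHarmonics] using this

lemma exists_conj (hY : IsHarmonicBasis d k Y) (h : ι) :
    ∃ p ∈ solidHarmonics d k, ∀ x : E d, ‖x‖ = 1 → starRingEnd ℂ (Y h x) = evalAt x p := by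
  obtain ⟨p, hp, hpY⟩ := hY.exists_solidHarmonic h
  refine ⟨map (starRingEnd ℂ) p, map_conj_mem_solidHarmonics hp, fun x hx => ?_⟩
  rw [← hpY, angularPart_apply_of_norm_eq_one p hx, evalAt_map_conj]

/-- Expansion of a harmonic over the orthonormal basis. -/
lemma evalAt_eq_sum [Fintype ι] (hY : IsHarmonicBasis d k Y) {q : MvPolynomial (Fin d) ℂ}
    (hq : q ∈ solidHarmonics d k) {x : E d} (hx : ‖x‖ = 1) :
    evalAt x q = ∑ h, Y h x *
      ∫ ω, evalAt (ω : E d) q * starRingEnd ℂ (Y h ω) ∂sphereMeasure d := by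
  have hmem : angularPart d q ∈ Submodule.span ℂ (Set.range Y) :=
    hY.span_eq ▸ Submodule.mem_map_of_mem hq
  obtain ⟨a, ha⟩ := (Submodule.mem_span_range_iff_exists_fun ℂ).1 hmem
  have hev : ∀ z : E d, ‖z‖ = 1 → evalAt z q = ∑ h, a h * Y h z := by
    intro z hz
    rw [← angularPart_apply_of_norm_eq_one q hz, ← ha]
    simp
  have hcoef : ∀ h, ∫ ω, evalAt (ω : E d) q * starRingEnd ℂ (Y h ω) ∂sphereMeasure d = a h := by
    intro h
    have hint : ∀ h' ∈ Finset.univ, Integrable (fun ω : Metric.sphere (0 : E d) 1 =>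
        a h' * (Y h' ω * starRingEnd ℂ (Y h ω))) (sphereMeasure d) := by
      intro h' _
      obtain ⟨p, -, hp⟩ := hY.exists_solidHarmonic h'
      obtain ⟨p', -, hp'⟩ := hY.exists_conj h
      refine ((integrable_evalAt_sphere (p * p')).const_mul (a h')).congr
        (Filter.Eventually.of_forall fun ω => ?_)
      have hω : ‖(ω : E d)‖ = 1 := by simp
      simp only [map_mul]
      rw [hp' _ hω, ← hp, angularPart_apply_of_norm_eq_one p hω]
    have : ∀ ω : Metric.sphere (0 : E d) 1, evalAt (ω : E d) q * starRingEnd ℂ (Y h ω) =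
        ∑ h', a h' * (Y h' ω * starRingEnd ℂ (Y h ω)) := by
      intro ω
      rw [hev ω (by simp), Finset.sum_mul]
      simp only [mul_assoc]
    simp only [this]
    rw [integral_finsetSum _ hint, Finset.sum_eq_single h]
    · rw [integral_const_mul, hY.norm_one, mul_one]
    · intro h' _ hh'
      rw [integral_const_mul, hY.orthogonal h' h hh', mul_zero]
    · simp
  rw [hev x hx]
  exact Finset.sum_congr rfl fun h _ => by rw [hcoef, mul_comm]

end IsHarmonicBasis

/-- The kernel `∑ₕ Yₖʰ(x) Yₖʰ(y)*`. -/
def kernel {ι : Type*} [Fintype ι] (Y : ι → E d → ℂ) (x y : E d) : ℂ :=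
  ∑ h, Y h x * starRingEnd ℂ (Y h y)

/-- Addition theorem, in terms of powers of the inner product. -/
theorem inner_pow_eq_sum_kernel (hd : 0 < d) {ι : ℕ → Type*} [∀ k, Fintype (ι k)]
    {Y : (k : ℕ) → ι k → E d → ℂ} (hY : ∀ k, IsHarmonicBasis d k (Y k)) (i : ℕ) {x y : E d}
    (hx : ‖x‖ = 1) (hy : ‖y‖ = 1) :
    ((inner ℝ x y : ℝ) : ℂ) ^ i = ∑ k ∈ Finset.range (i + 1), ZA d k i * kernel (Y k) x y := by
  have hl : (linForm y ^ i).IsHomogeneous i := by simpa using (isHomogeneous_linForm y).pow i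
  obtain ⟨q, hq, hqx⟩ := exists_eq_sum_solidHarmonics (mem_harmonicSpan hd hl)
  have hxi := hqx x hx
  rw [map_pow, evalAt_linForm] at hxi
  rw [hxi]
  refine Finset.sum_congr rfl fun k hk => ?_
  rw [(hY k).evalAt_eq_sum (hq k) hx, kernel, Finset.mul_sum]
  refine Finset.sum_congr rfl fun h _ => ?_
  obtain ⟨p, hp, hpY⟩ := (hY k).exists_conj h
  -- Components of other degrees are orthogonal to `p`, so the unknown `q k` may be replaced by the
  -- whole power, to which Funk–Hecke applies.
  have h1 : ∫ ω, evalAt (ω : E d) (q k) * starRingEnd ℂ (Y k h ω) ∂sphereMeasure d =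
      ∫ ω, evalAt (ω : E d) (linForm y ^ i * p) ∂sphereMeasure d := by
    have hω : ∀ ω : Metric.sphere (0 : E d) 1, ‖(ω : E d)‖ = 1 := fun ω => by simp
    have e1 : ∀ ω : Metric.sphere (0 : E d) 1, evalAt (ω : E d) (linForm y ^ i * p) =
        ∑ l ∈ Finset.range (i + 1), evalAt (ω : E d) (q l * p) := by
      intro ω
      simp only [map_mul]
      rw [hqx ω (hω ω), Finset.sum_mul]
    simp only [e1]
    rw [integral_finsetSum _ fun l _ => integrable_evalAt_sphere (q l * p),
      Finset.sum_eq_single_of_mem k hk]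
    · refine integral_congr_ae (Filter.Eventually.of_forall fun ω => ?_)
      simp only [map_mul]
      rw [hpY _ (hω ω)]
    · intro l _ hl
      exact integral_sphere_mul_eq_zero hd hl (hq l) hp
  rw [h1, integral_sphere_linForm_pow_mul hd hy i hp, hpY y hy]
  ring

lemma sphereArea_pos (hd : 0 < d) : 0 < sphereArea d := by
  have : 0 < Real.Gamma ((d : ℝ) / 2) := Real.Gamma_pos_of_pos (by positivity)
  rw [sphereArea]
  positivity

lemma ZA_nonneg (hd : 0 < d) (k i : ℕ) : 0 ≤ ZA d k i := by
  rw [ZA]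
  split_ifs
  · have := sphereArea_pos hd
    have := ascPochhammer_pos ((i + k) / 2) ((d : ℝ) / 2) (by positivity)
    positivity
  · rfl

/-- Since d/2 ≥ 1, the Pochhammer symbol dominates a factorial; what remains is a binomial
coefficient of i, at most 2ⁱ. -/
lemma ZA_le (hd : 2 ≤ d) (k i : ℕ) : ZA d k i ≤ sphereArea d := by
  have hA := sphereArea_pos (d := d) (by omega)
  rw [ZA]
  split_ifs with h
  · obtain ⟨hk, a, ha⟩ := h
    obtain rfl : i = k + 2 * a := by omega
    rw [show (k + 2 * a - k) / 2 = a by omega, show (k + 2 * a + k) / 2 = k + a by omega]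
    have hd' : (1 : ℝ) ≤ (d : ℝ) / 2 := by
      have : (2 : ℝ) ≤ d := by exact_mod_cast hd
      linarith
    have hp : ∀ n : ℕ, (n ! : ℝ) ≤ (ascPochhammer ℝ n).eval ((d : ℝ) / 2) := by
      intro n
      induction n with
      | zero => simp
      | succ n ih =>
        rw [ascPochhammer_succ_eval, Nat.factorial_succ, mul_comm]
        push_cast
        exact mul_le_mul ih (by linarith) (by positivity) ((Nat.cast_nonneg _).trans ih)
    have hpos : 0 < (ascPochhammer ℝ (k + a)).eval ((d : ℝ) / 2) :=
      ascPochhammer_pos _ _ (by linarith)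
    rw [div_le_iff₀ (by positivity)]
    refine mul_le_mul_of_nonneg_left ?_ hA.le
    have hc : ((k + 2 * a).choose a * a ! * (k + a)! : ℝ) = (k + 2 * a)! := by
      have := Nat.choose_mul_factorial_mul_factorial (show a ≤ k + 2 * a by omega)
      rw [show k + 2 * a - a = k + a by omega] at this
      exact_mod_cast this
    rw [← hc]
    have h2 : ((k + 2 * a).choose a : ℝ) ≤ 2 ^ (k + 2 * a) := by
      exact_mod_cast Nat.choose_le_two_pow _ _
    have := hp (k + a)
    gcongr
  · exact hA.le

lemma ZA_eq_zero_of_lt {k i : ℕ} (h : i < k) : ZA d k i = 0 := by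
  rw [ZA, if_neg fun h' => absurd h'.1 (by omega)]

lemma norm_kernel_le {ι : Type*} [Fintype ι] (Y : ι → E d → ℂ) (x y : E d) :
    ‖kernel Y x y‖ ≤ ((kernel Y x x).re + (kernel Y y y).re) / 2 := by
  have h : ∀ z : E d, (kernel Y z z).re = ∑ h, ‖Y h z‖ ^ 2 := by
    intro z
    simp only [kernel, Complex.mul_conj, Complex.re_sum, Complex.ofReal_re,
      Complex.normSq_eq_norm_sq]
  rw [h, h, ← Finset.sum_add_distrib, Finset.sum_div]
  refine (norm_sum_le _ _).trans (Finset.sum_le_sum fun h _ => ?_)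
  rw [norm_mul, RCLike.norm_conj]
  nlinarith [sq_nonneg (‖Y h x‖ - ‖Y h y‖)]

/-- On the diagonal the expansion of 1ⁱ has nonnegative terms with sum 1; the AM–GM bound
`norm_kernel_le` carries this to x ≠ y. No growth estimate for the harmonics is needed. -/
lemma sum_ZA_mul_norm_kernel_le (hd : 0 < d) {ι : ℕ → Type*} [∀ k, Fintype (ι k)]
    {Y : (k : ℕ) → ι k → E d → ℂ} (hY : ∀ k, IsHarmonicBasis d k (Y k)) (i : ℕ) {x y : E d}
    (hx : ‖x‖ = 1) (hy : ‖y‖ = 1) :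
    ∑ k ∈ Finset.range (i + 1), ZA d k i * ‖kernel (Y k) x y‖ ≤ 1 := by
  have h1 : ∀ z : E d, ‖z‖ = 1 →
      ∑ k ∈ Finset.range (i + 1), ZA d k i * (kernel (Y k) z z).re = 1 := by
    intro z hz
    have := congrArg Complex.re (inner_pow_eq_sum_kernel hd hY i hz hz)
    rw [real_inner_self_eq_norm_sq, hz] at this
    simpa [Complex.re_ofReal_mul] using this.symm
  calc _ ≤ ∑ k ∈ Finset.range (i + 1),
        ZA d k i * (((kernel (Y k) x x).re + (kernel (Y k) y y).re) / 2) :=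
        Finset.sum_le_sum fun k _ =>
          mul_le_mul_of_nonneg_left (norm_kernel_le _ _ _) (ZA_nonneg hd k i)
    _ = 1 := by
      have hx1 := h1 x hx
      have hy1 := h1 y hy
      simp only [mul_div_assoc', mul_add, ← Finset.sum_div, Finset.sum_add_distrib]
      rw [hx1, hy1]
      norm_num

end FKT

/-! ### Taylor series of ε ↦ K(r √(1 + ε)) -/

namespace FKT

open Filter Topology

lemma B_zero_right (n : ℕ) : B n 0 = if n = 0 then 1 else 0 := by simp [B]

lemma B_eq_zero_of_lt {n m : ℕ} (h : n < m) : B n m = 0 := by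
  rw [B, if_neg (by omega), if_pos h]

lemma B_of_le {n m : ℕ} (hm : m ≠ 0) (h : m ≤ n) :
    B n m = (-1) ^ (n + m) * ((2 * n - 2 * m - 1)‼ : ℝ) / 2 ^ n *
      ((2 * n - m - 1).choose (m - 1) : ℝ) := by
  rw [B, if_neg hm, if_neg (by omega)]

lemma B_self (n : ℕ) : B n n = 1 / 2 ^ n := by
  rcases n with _ | n
  · simp [B]
  · rw [B_of_le (by omega) le_rfl, show 2 * (n + 1) - 2 * (n + 1) - 1 = 0 by omega,
      show 2 * (n + 1) - (n + 1) - 1 = n by omega, Nat.add_sub_cancel, Nat.choose_self, ← two_mul,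
      pow_mul]
    simp

lemma B_succ_zero (n : ℕ) : B (n + 1) 0 = -(n : ℝ) * B n 0 := by
  rcases n with _ | n <;> simp [B_zero_right]

/-- This is the recursion produced by differentiating u^(m-2n) K⁽ᵐ⁾(ru), u = √(1 + ε). For m ≥ 1 and
n > m it reduces to Pascal's rule and an absorption identity. -/
lemma B_succ_succ (n m : ℕ) :
    B (n + 1) (m + 1) = 1 / 2 * B n m + (((m + 1 : ℕ) : ℝ) / 2 - n) * B n (m + 1) := by
  rcases lt_trichotomy n m with h | rfl | h
  · rw [B_eq_zero_of_lt h, B_eq_zero_of_lt (show n + 1 < m + 1 by omega),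
      B_eq_zero_of_lt (show n < m + 1 by omega)]
    simp
  · rw [B_self, B_self, B_eq_zero_of_lt (show n < n + 1 by omega), pow_succ]
    field_simp
    ring
  · obtain ⟨a, rfl⟩ := Nat.exists_eq_add_of_lt h
    -- At a = 0 the truncated 2a - 1 is 0, and 0‼ = 1 stands in for (-1)‼.
    have hdf : ((2 * a + 1)‼ : ℝ) = (2 * a + 1) * ((2 * a - 1)‼ : ℕ) := by
      rcases a with _ | a
      · simp
      · rw [show 2 * (a + 1) + 1 = (2 * a + 1) + 2 by ring, Nat.doubleFactorial_add_two,
          show 2 * (a + 1) - 1 = 2 * a + 1 by omega]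
        push_cast
        ring
    rcases m with _ | m
    · rw [B_zero_right, if_neg (by omega), B_of_le (by omega) (by omega),
        B_of_le (by omega) (by omega),
        show 2 * (0 + a + 1 + 1) - 2 * (0 + 1) - 1 = 2 * a + 1 by omega,
        show 2 * (0 + a + 1) - 2 * (0 + 1) - 1 = 2 * a - 1 by omega, hdf]
      simp only [zero_add, Nat.sub_self, Nat.choose_zero_right, Nat.cast_one, pow_succ]
      push_cast
      field_simp
      ring
    · have pascal : ((m + 2 * a + 3).choose (m + 1) : ℝ) =
          (m + 2 * a + 2).choose m + (m + 2 * a + 2).choose (m + 1) := by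
        exact_mod_cast Nat.choose_succ_succ (m + 2 * a + 2) m
      have absorb : ((m + 2 * a + 1).choose (m + 1) : ℝ) * (m + 2 * a + 2) =
          (m + 2 * a + 2).choose (m + 1) * (2 * a + 1) := by
        have := Nat.choose_mul_succ_eq (m + 2 * a + 1) (m + 1)
        rw [show m + 2 * a + 1 + 1 - (m + 1) = 2 * a + 1 by omega] at this
        exact_mod_cast this
      rw [B_of_le (by omega) (by omega), B_of_le (by omega) (by omega),
        B_of_le (by omega) (by omega),
        show 2 * (m + 1 + a + 1 + 1) - 2 * (m + 1 + 1) - 1 = 2 * a + 1 by omega,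
        show 2 * (m + 1 + a + 1) - 2 * (m + 1) - 1 = 2 * a + 1 by omega,
        show 2 * (m + 1 + a + 1) - 2 * (m + 1 + 1) - 1 = 2 * a - 1 by omega,
        show 2 * (m + 1 + a + 1 + 1) - (m + 1 + 1) - 1 = m + 2 * a + 3 by omega,
        show 2 * (m + 1 + a + 1) - (m + 1) - 1 = m + 2 * a + 2 by omega,
        show 2 * (m + 1 + a + 1) - (m + 1 + 1) - 1 = m + 2 * a + 1 by omega,
        show m + 1 + 1 - 1 = m + 1 by omega, show m + 1 - 1 = m by omega, pascal, hdf]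
      have e1 : (-1 : ℝ) ^ (m + 1 + a + 1 + 1 + (m + 1 + 1)) = (-1) ^ a * (-1) := by
        rw [show m + 1 + a + 1 + 1 + (m + 1 + 1) = 2 * (m + 2) + a + 1 by ring, pow_succ, pow_add,
          pow_mul]; simp
      have e2 : (-1 : ℝ) ^ (m + 1 + a + 1 + (m + 1)) = (-1) ^ a * (-1) := by
        rw [show m + 1 + a + 1 + (m + 1) = 2 * (m + 1) + a + 1 by ring, pow_succ, pow_add,
          pow_mul]; simp
      have e3 : (-1 : ℝ) ^ (m + 1 + a + 1 + (m + 1 + 1)) = (-1) ^ a := by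
        rw [show m + 1 + a + 1 + (m + 1 + 1) = 2 * (m + 2) + a by ring, pow_add, pow_mul]; simp
      rw [e1, e2, e3, pow_succ (2 : ℝ) (m + 1 + a + 1)]
      push_cast
      field_simp
      linear_combination absorb

/-- The function `ε ↦ K (r √(1 + ε))`. -/
def sqrtComp (K : ℝ → ℂ) (r ε : ℝ) : ℂ := K (r * √(1 + ε))

/-- The Taylor coefficients at `0` of `ε ↦ K (r √(1 + ε))`. -/
def taylorCoeff (K : ℝ → ℂ) (r : ℝ) (n : ℕ) : ℂ := iteratedDeriv n (sqrtComp K r) 0 / (n ! : ℂ)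

variable {K : ℝ → ℂ} {r : ℝ}

/-- Only ε = 0 is used later, but the induction differentiates the formula and so needs it on an
open set. -/
lemma iteratedDeriv_sqrtComp (hr : 0 < r) (hK : AnalyticOnNhd ℝ K (Set.Ioi 0)) (n : ℕ) :
    ∀ ε : ℝ, -1 < ε → iteratedDeriv n (sqrtComp K r) ε =
      ∑ m ∈ Finset.range (n + 1), (B n m : ℂ) * (r : ℂ) ^ m *
        (((√(1 + ε)) ^ ((m : ℤ) - 2 * n) : ℝ) * iteratedDeriv m K (r * √(1 + ε))) := by
  induction n with
  | zero =>
    intro ε _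
    simp [B_zero_right, sqrtComp]
  | succ n ih =>
    intro ε hε
    have hev : iteratedDeriv n (sqrtComp K r) =ᶠ[𝓝 ε] fun ε =>
        ∑ m ∈ Finset.range (n + 1), (B n m : ℂ) * (r : ℂ) ^ m *
          (((√(1 + ε)) ^ ((m : ℤ) - 2 * n) : ℝ) * iteratedDeriv m K (r * √(1 + ε))) := by
      filter_upwards [Ioi_mem_nhds hε] with y hy using ih y hy
    rw [iteratedDeriv_succ, hev.deriv_eq]
    set u := √(1 + ε) with hu
    have hu0 : 0 < u := Real.sqrt_pos.2 (by linarith)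
    have hsq : HasDerivAt (fun y : ℝ => √(1 + y)) (1 / (2 * u)) ε := by
      have := ((hasDerivAt_id ε).const_add 1).sqrt (by simp; linarith)
      simpa using this
    have hterm : ∀ m : ℕ, HasDerivAt (fun ε : ℝ =>
        (((√(1 + ε)) ^ ((m : ℤ) - 2 * n) : ℝ) * iteratedDeriv m K (r * √(1 + ε)) : ℂ))
        ((((m : ℝ) / 2 - n) * u ^ ((m : ℤ) - 2 * (n + 1 : ℕ)) : ℝ) * iteratedDeriv m K (r * u) +
          (u ^ (((m + 1 : ℕ) : ℤ) - 2 * (n + 1 : ℕ)) : ℝ) * (r / 2) *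
            iteratedDeriv (m + 1) K (r * u)) ε := by
      intro m
      have hpow := ((hasDerivAt_zpow ((m : ℤ) - 2 * n) u (Or.inl hu0.ne')).comp ε hsq).ofReal_comp
      have hKm : HasDerivAt (iteratedDeriv m K) (iteratedDeriv (m + 1) K (r * u)) (r * u) := by
        rw [iteratedDeriv_succ]
        refine DifferentiableAt.hasDerivAt ?_
        rw [iteratedDeriv_eq_iterate]
        exact ((hK.iterated_deriv m) _ (mul_pos hr hu0)).differentiableAt
      have hcomp := hKm.scomp ε (hsq.const_mul r)
      refine (hpow.mul hcomp).congr_deriv ?_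
      have z1 : u ^ ((m : ℤ) - 2 * n - 1) = u ^ ((m : ℤ) - 2 * (n + 1 : ℕ)) * u := by
        rw [← zpow_add_one₀ hu0.ne']; congr 1; push_cast; ring
      have z2 : u ^ ((m : ℤ) - 2 * n) = u ^ ((m : ℤ) - 2 * (n + 1 : ℕ)) * u * u := by
        rw [← zpow_add_one₀ hu0.ne', ← zpow_add_one₀ hu0.ne']; congr 1; push_cast; ring
      have z3 : u ^ (((m + 1 : ℕ) : ℤ) - 2 * (n + 1 : ℕ)) =
          u ^ ((m : ℤ) - 2 * (n + 1 : ℕ)) * u := by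
        rw [← zpow_add_one₀ hu0.ne']; congr 1; push_cast; ring
      have hu0' : (u : ℂ) ≠ 0 := by exact_mod_cast hu0.ne'
      simp only [Function.comp_def, ← hu, z1, z2, z3]
      generalize u ^ ((m : ℤ) - 2 * (n + 1 : ℕ)) = w
      rw [Complex.real_smul]
      push_cast
      field_simp
    have hsum := HasDerivAt.fun_sum (u := Finset.range (n + 1)) fun m _ =>
      (hterm m).const_mul ((B n m : ℂ) * (r : ℂ) ^ m)
    rw [hsum.deriv, Finset.sum_range_succ' _ (n + 1)]
    -- Shifting m by one lines up the terms where the power of u was differentiated with those where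
    -- K⁽ᵐ⁾ was.
    have hlast : ∀ g : ℕ → ℂ, ∑ m ∈ Finset.range (n + 1), (B n m : ℂ) * g m =
        ∑ m ∈ Finset.range (n + 1), (B n (m + 1) : ℂ) * g (m + 1) + (B n 0 : ℂ) * g 0 := by
      intro g
      rw [← Finset.sum_range_succ' (fun m => (B n m : ℂ) * g m), Finset.sum_range_succ _ (n + 1),
        B_eq_zero_of_lt (Nat.lt_succ_self n)]
      simp
    simp only [mul_add, Finset.sum_add_distrib, mul_assoc]
    rw [hlast, add_right_comm, ← Finset.sum_add_distrib, B_succ_zero]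
    congr 1
    · refine Finset.sum_congr rfl fun m _ => ?_
      rw [B_succ_succ]
      push_cast
      ring
    · push_cast
      ring

lemma taylorCoeff_eq (hr : 0 < r) (hK : AnalyticOnNhd ℝ K (Set.Ioi 0)) (n : ℕ) :
    taylorCoeff K r n =
      (∑ m ∈ Finset.range (n + 1), (B n m : ℂ) * (r : ℂ) ^ m * iteratedDeriv m K r) /
        (n ! : ℂ) := by
  rw [taylorCoeff, iteratedDeriv_sqrtComp hr hK n 0 (by norm_num)]
  simp

lemma taylorRadius_eq : taylorRadius K r =
    (FormalMultilinearSeries.ofScalars ℂ (taylorCoeff K r)).radius := rfl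

lemma analyticAt_sqrtComp (hr : 0 < r) (hK : AnalyticOnNhd ℝ K (Set.Ioi 0)) {ε : ℝ}
    (hε : -1 < ε) : AnalyticAt ℝ (sqrtComp K r) ε := by
  have h1 : 0 < 1 + ε := by linarith
  have hs : AnalyticAt ℝ Real.sqrt (1 + ε) :=
    (Real.contDiffAt_sqrt h1.ne').analyticAt
  have hinner : AnalyticAt ℝ (fun ε : ℝ => r * √(1 + ε)) ε :=
    analyticAt_const.mul (hs.comp (analyticAt_const.add analyticAt_id))
  change AnalyticAt ℝ (fun ε => K (r * √(1 + ε))) ε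
  exact AnalyticAt.fun_comp (hK _ (mul_pos hr (Real.sqrt_pos.2 h1))) hinner

/-- The Taylor series of `ε ↦ K (r √(1 + ε))` at `0` represents this function on the part of
`[-1, ∞)` in the disc of convergence. -/
theorem hasSum_taylorCoeff (hr : 0 < r) (hK : AnalyticOnNhd ℝ K (Set.Ioi 0)) {ε : ℝ}
    (h1 : -1 ≤ ε) (hR : ENNReal.ofReal |ε| < taylorRadius K r)
    (h0 : ε = -1 → ContinuousWithinAt K (Set.Ioi 0) 0) :
    HasSum (fun n => taylorCoeff K r n * (ε : ℂ) ^ n) (K (r * √(1 + ε))) := by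
  rw [taylorRadius_eq] at hR
  set p := FormalMultilinearSeries.ofScalars ℂ (taylorCoeff K r) with hp
  have hpos : 0 < p.radius := bot_le.trans_lt hR
  have hball := p.hasFPowerSeriesOnBall hpos
  have hmem : ∀ y : ℝ, ENNReal.ofReal |y| < p.radius → (y : ℂ) ∈ Metric.eball (0 : ℂ) p.radius := by
    intro y hy
    rw [Metric.mem_eball, edist_zero_right, ← ofReal_norm, Complex.norm_real]
    exact hy
  have hsum : ∀ y : ℝ, ENNReal.ofReal |y| < p.radius →
      HasSum (fun n => taylorCoeff K r n * (y : ℂ) ^ n) (p.sum y) := by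
    intro y hy
    have := hball.hasSum (hmem y hy)
    simpa [hp, FormalMultilinearSeries.ofScalars_apply_eq, mul_comm] using this
  have hG : ∀ y : ℝ, ENNReal.ofReal |y| < p.radius →
      AnalyticAt ℝ (fun y : ℝ => p.sum (y : ℂ)) y := by
    intro y hy
    have := (hball.analyticAt_of_mem (hmem y hy)).restrictScalars (𝕜 := ℝ)
    exact this.comp (Complex.ofRealCLM.analyticAt y)
  set U : Set ℝ := {y | ENNReal.ofReal |y| < p.radius} ∩ Set.Ioi (-1) with hU
  have hord : Set.OrdConnected {y : ℝ | ENNReal.ofReal |y| < p.radius} := by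
    refine ⟨fun a ha b hb y hy => ?_⟩
    refine lt_of_le_of_lt (ENNReal.ofReal_le_ofReal (abs_le_max_abs_abs hy.1 hy.2)) ?_
    rcases max_choice |a| |b| with h | h <;> rw [h] <;> assumption
  have hconn : IsPreconnected U := (hord.inter Set.ordConnected_Ioi).isPreconnected
  -- Analyticity gives equality with the Taylor series only near 0; the identity theorem extends it
  -- to the interval `U`.
  have hnear : sqrtComp K r =ᶠ[𝓝 0] fun y : ℝ => p.sum (y : ℂ) := by
    obtain ⟨q, ρ, hq⟩ := analyticAt_sqrtComp hr hK (ε := 0) (by norm_num)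
    have hopen : ∀ᶠ y : ℝ in 𝓝 0, ENNReal.ofReal |y| < p.radius := by
      have hc : Continuous fun y : ℝ => ENNReal.ofReal |y| :=
          ENNReal.continuous_ofReal.comp continuous_abs
      exact hc.continuousAt.eventually_lt continuousAt_const (by simpa using hpos)
    filter_upwards [hopen, Metric.eball_mem_nhds 0 hq.r_pos] with y hy hyq
    have h := hq.hasSum_iteratedFDeriv hyq
    rw [zero_add] at h
    refine h.unique ((hsum y hy).congr_fun ?_)
    intro n
    rw [iteratedFDeriv_apply_eq_iteratedDeriv_mul_prod, taylorCoeff]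
    simp [Complex.real_smul]
    ring
  have h0U : (0 : ℝ) ∈ U := ⟨by simpa using hpos, by simp⟩
  have heq : Set.EqOn (sqrtComp K r) (fun y : ℝ => p.sum (y : ℂ)) U :=
    AnalyticOnNhd.eqOn_of_preconnected_of_eventuallyEq
      (fun y hy => analyticAt_sqrtComp hr hK hy.2) (fun y hy => hG y hy.1) hconn h0U hnear
  have hval : K (r * √(1 + ε)) = p.sum (ε : ℂ) := by
    -- At ε = -1 the argument of K is 0, outside the domain of analyticity; both sides are compared
    -- through their right limits.
    rcases h1.eq_or_lt with rfl | h1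
    · have hK0 := h0 rfl
      have hlim1 : Tendsto (sqrtComp K r) (𝓝[>] (-1)) (𝓝 (K 0)) := by
        refine hK0.tendsto.comp (tendsto_nhdsWithin_iff.2 ⟨?_, ?_⟩)
        · have hc : Continuous fun y : ℝ => r * √(1 + y) := by fun_prop
          have := hc.tendsto (-1)
          simp only [add_neg_cancel, Real.sqrt_zero, mul_zero] at this
          exact this.mono_left nhdsWithin_le_nhds
        · filter_upwards [self_mem_nhdsWithin] with y hy
          have hy : -1 < y := hy
          exact mul_pos hr (Real.sqrt_pos.2 (by linarith))
      have hlim2 : Tendsto (fun y : ℝ => p.sum (y : ℂ)) (𝓝[>] (-1)) (𝓝 (p.sum ((-1 : ℝ) : ℂ))) :=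
        (hG (-1) hR).continuousAt.tendsto.mono_left nhdsWithin_le_nhds
      have hev : sqrtComp K r =ᶠ[𝓝[>] (-1)] fun y : ℝ => p.sum (y : ℂ) := by
        have hopen : ∀ᶠ y : ℝ in 𝓝 (-1), ENNReal.ofReal |y| < p.radius := by
          have hc : Continuous fun y : ℝ => ENNReal.ofReal |y| :=
          ENNReal.continuous_ofReal.comp continuous_abs
          exact hc.continuousAt.eventually_lt continuousAt_const hR
        filter_upwards [self_mem_nhdsWithin, hopen.filter_mono nhdsWithin_le_nhds] with y hy hy'
        exact heq ⟨hy', hy⟩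
      have := tendsto_nhds_unique (hlim1.congr' hev) hlim2
      simpa using this
    · exact heq ⟨hR, h1⟩
  rw [hval]
  exact hsum ε hR

lemma summable_norm_taylorCoeff {ρ : ℝ} (hρ : 0 ≤ ρ)
    (hR : ENNReal.ofReal ρ < taylorRadius K r) :
    Summable fun n => ‖taylorCoeff K r n‖ * ρ ^ n := by
  rw [taylorRadius_eq] at hR
  have := FormalMultilinearSeries.summable_norm_mul_pow _ (r := ρ.toNNReal) hR
  simpa [FormalMultilinearSeries.ofScalars_norm, Real.coe_toNNReal _ hρ] using this

end FKT

/-! ### Rearrangement of the multiple series -/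

namespace FKT

/-- The coefficient of `tⁱ`, `i = p.1`, in `c_{i+q} (s² - 2 s t)^(i+q)`, `q = p.2`. -/
def expandTerm (c : ℕ → ℂ) (s : ℝ) (p : ℕ × ℕ) : ℂ :=
  c (p.1 + p.2) * (p.1 + p.2).choose p.1 * (-2) ^ p.1 * (s : ℂ) ^ (p.1 + 2 * p.2)

variable {c : ℕ → ℂ} {s : ℝ}

/-- On the antidiagonal i + q = n the norms add up, by the binomial theorem, to exactly ‖cₙ‖ (2s +
s²)ⁿ. -/
lemma summable_norm_expandTerm (hs : 0 ≤ s) (hc : Summable fun n => ‖c n‖ * (s * (s + 2)) ^ n) :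
    Summable fun p => ‖expandTerm c s p‖ := by
  rw [← Finset.HasAntidiagonal.sigmaAntidiagonalEquivProd.summable_iff, Function.comp_def,
    summable_sigma_of_nonneg
    fun _ => norm_nonneg _]
  refine ⟨fun n => Summable.of_finite, hc.congr fun n => ?_⟩
  rw [tsum_fintype, show s * (s + 2) = 2 * s + s ^ 2 by ring, (Commute.all _ _).add_pow',
    Finset.mul_sum, ← Finset.sum_coe_sort]
  refine Finset.sum_congr rfl fun p _ => ?_
  obtain ⟨⟨i, q⟩, hp⟩ := p
  obtain rfl : i + q = n := by simpa using hp
  simp only [Finset.HasAntidiagonal.sigmaAntidiagonalEquivProd, Equiv.coe_fn_mk, expandTerm,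
    norm_mul, norm_pow, norm_neg, Complex.norm_real, Real.norm_of_nonneg hs, nsmul_eq_mul,
    RCLike.norm_natCast, RCLike.norm_ofNat]
  ring

lemma hasSum_expandTerm (hs : 0 ≤ s) (hc : Summable fun n => ‖c n‖ * (s * (s + 2)) ^ n)
    {t : ℝ} (ht : |t| ≤ 1) {S : ℂ}
    (hS : HasSum (fun n => c n * ((s * (s - 2 * t) : ℝ) : ℂ) ^ n) S) :
    HasSum (fun p => expandTerm c s p * (t : ℂ) ^ p.1) S := by
  have hsum : Summable fun p => expandTerm c s p * (t : ℂ) ^ p.1 := by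
    refine Summable.of_norm_bounded (summable_norm_expandTerm hs hc) fun p => ?_
    rw [norm_mul, norm_pow, Complex.norm_real]
    exact mul_le_of_le_one_right (norm_nonneg _) (pow_le_one₀ (abs_nonneg _) ht)
  have h := (Finset.HasAntidiagonal.sigmaAntidiagonalEquivProd.hasSum_iff.2 hsum.hasSum).sigma
    fun n => hasSum_fintype _
  rw [hS.unique (h.congr_fun fun n => ?_)]
  · exact hsum.hasSum
  · rw [show ((s * (s - 2 * t) : ℝ) : ℂ) = -2 * s * t + (s : ℂ) ^ 2 by push_cast; ring,
      (Commute.all _ _).add_pow', Finset.mul_sum, ← Finset.sum_coe_sort]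
    refine Finset.sum_congr rfl fun p _ => ?_
    obtain ⟨⟨i, q⟩, hp⟩ := p
    obtain rfl : i + q = n := by simpa using hp
    simp only [Finset.HasAntidiagonal.sigmaAntidiagonalEquivProd, Equiv.coe_fn_mk,
      Function.comp_apply, expandTerm, nsmul_eq_mul]
    ring

variable {d : ℕ}

lemma summable_expandTerm_mul_ZA (hd : 2 ≤ d) (hs : 0 ≤ s)
    (hc : Summable fun n => ‖c n‖ * (s * (s + 2)) ^ n) (k : ℕ) :
    Summable fun p : ℕ × ℕ => expandTerm c s p * (ZA d k p.1 : ℂ) := by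
  refine Summable.of_norm_bounded ((summable_norm_expandTerm hs hc).mul_right (sphereArea d))
    fun p => ?_
  rw [norm_mul, Complex.norm_real, Real.norm_of_nonneg (ZA_nonneg (by omega) _ _)]
  exact mul_le_mul_of_nonneg_left (ZA_le hd _ _) (norm_nonneg _)

/-- Expansion of `∑ₙ cₙ (s² - 2 s x⬝y)ⁿ` in hyperspherical harmonics of the unit vectors `x`,
`y`. -/
theorem hasSum_kernel_mul (hd : 2 ≤ d) {ι : ℕ → Type*} [∀ k, Fintype (ι k)]
    {Y : (k : ℕ) → ι k → E d → ℂ} (hY : ∀ k, IsHarmonicBasis d k (Y k)) {x y : E d}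
    (hx : ‖x‖ = 1) (hy : ‖y‖ = 1) (hs : 0 ≤ s)
    (hc : Summable fun n => ‖c n‖ * (s * (s + 2)) ^ n) {S : ℂ}
    (hS : HasSum (fun n => c n * ((s * (s - 2 * inner ℝ x y) : ℝ) : ℂ) ^ n) S) :
    HasSum (fun k => kernel (Y k) x y * ∑' p : ℕ × ℕ, expandTerm c s p * (ZA d k p.1 : ℂ)) S := by
  have hd0 : 0 < d := by omega
  have ht : |inner ℝ x y| ≤ 1 := by
    simpa [hx, hy] using abs_real_inner_le_norm x y
  -- The full triple family: summing over k first recovers the Taylor series, summing over (i, q)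
  -- first gives the harmonic expansion.
  set g : (ℕ × ℕ) × ℕ → ℂ := fun a =>
    expandTerm c s a.1 * (ZA d a.2 a.1.1 * kernel (Y a.2) x y) with hg
  have hzero : ∀ (p : ℕ × ℕ), ∀ k ∉ Finset.range (p.1 + 1), g (p, k) = 0 := by
    intro p k hk
    have hk' : p.1 < k := by rw [Finset.mem_range] at hk; omega
    simp [hg, ZA_eq_zero_of_lt hk']
  have hsum : Summable g := by
    refine Summable.of_norm ?_
    rw [summable_prod_of_nonneg fun _ => norm_nonneg _]
    have hz : ∀ (p : ℕ × ℕ), ∀ k ∉ Finset.range (p.1 + 1), ‖g (p, k)‖ = 0 :=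
      fun p k hk => by rw [hzero p k hk, norm_zero]
    refine ⟨fun p => summable_of_ne_finset_zero (hz p), ?_⟩
    refine Summable.of_nonneg_of_le (fun p => tsum_nonneg fun _ => norm_nonneg _) (fun p => ?_)
      (summable_norm_expandTerm hs hc)
    rw [tsum_eq_sum (hz p)]
    calc _ = ‖expandTerm c s p‖ *
          ∑ k ∈ Finset.range (p.1 + 1), ZA d k p.1 * ‖kernel (Y k) x y‖ := by
          rw [Finset.mul_sum]
          refine Finset.sum_congr rfl fun k _ => ?_
          rw [hg, norm_mul, norm_mul, Complex.norm_real, Real.norm_of_nonneg (ZA_nonneg hd0 _ _)]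
      _ ≤ _ := mul_le_of_le_one_right (norm_nonneg _) (sum_ZA_mul_norm_kernel_le hd0 hY _ hx hy)
  have h1 := hsum.hasSum.prod_fiberwise fun p => hasSum_sum_of_ne_finset_zero (hzero p)
  have h2 : HasSum g S := by
    rw [(hasSum_expandTerm hs hc ht hS).unique (h1.congr_fun fun p => ?_)]
    · exact hsum.hasSum
    · rw [inner_pow_eq_sum_kernel hd0 hY _ hx hy, Finset.mul_sum]
  have h3 := ((Equiv.prodComm _ _).hasSum_iff.2 h2).prod_fiberwise fun k =>
    ((summable_expandTerm_mul_ZA hd hs hc k).hasSum.mul_left (kernel (Y k) x y)).congr_fun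
      fun p => by
        change expandTerm c s p * (ZA d k p.1 * kernel (Y k) x y) = _
        ring
  exact h3

/-- The added terms vanish, through `B` if n < m and through `ZA` if 2n - j < k. With a range free
of m and k, the sums over n and m can be exchanged. -/
lemma T_eq (j k m : ℕ) : T d j k m = ∑ n ∈ Finset.Icc ((j + 1) / 2) j,
    ZA d k (2 * n - j) * (-2) ^ (2 * n - j) * (n.choose (2 * n - j) : ℝ) / (n ! : ℝ) * B n m := by
  refine Finset.sum_subset (fun n hn => ?_) fun n hn hn' => ?_
  · rw [Finset.mem_Icc] at hn ⊢
    omega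
  · rw [Finset.mem_Icc] at hn hn'
    by_cases h : n < m
    · rw [B_eq_zero_of_lt h, mul_zero]
    · rw [ZA_eq_zero_of_lt (by omega)]
      simp

/-- The pairs `(i, q)` with `i + 2 q = j`. -/
def fiber (j : ℕ) : Finset (ℕ × ℕ) :=
  (Finset.Icc ((j + 1) / 2) j).image fun n => (2 * n - j, j - n)

lemma mem_fiber {j : ℕ} {p : ℕ × ℕ} : p ∈ fiber j ↔ p.1 + 2 * p.2 = j := by
  obtain ⟨i, q⟩ := p
  simp only [fiber, Finset.mem_image, Finset.mem_Icc, Prod.mk.injEq]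
  constructor
  · rintro ⟨n, hn, rfl, rfl⟩
    omega
  · rintro rfl
    exact ⟨i + q, by omega, by omega, by omega⟩

variable {K : ℝ → ℂ} {r r' : ℝ}

lemma radialTerm_eq_sum_fiber (hr : 0 < r) (hK : AnalyticOnNhd ℝ K (Set.Ioi 0)) (k j : ℕ) :
    radialTerm d K k r' r j =
      ∑ p ∈ fiber j, expandTerm (taylorCoeff K r) (r' / r) p * (ZA d k p.1 : ℂ) := by
  have hr0 : (r : ℂ) ≠ 0 := by exact_mod_cast hr.ne'
  rw [fiber, Finset.sum_image, radialTerm]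
  · simp only [T_eq, Complex.ofReal_sum, Finset.mul_sum]
    rw [Finset.sum_comm]
    refine Finset.sum_congr rfl fun n hn => ?_
    rw [Finset.mem_Icc] at hn
    have hn1 : 2 * n - j + (j - n) = n := by omega
    have hn2 : 2 * n - j + 2 * (j - n) = j := by omega
    simp only [expandTerm]
    rw [hn1, hn2, taylorCoeff_eq hr hK]
    have hext : ∑ m ∈ Finset.range (n + 1), (B n m : ℂ) * (r : ℂ) ^ m * iteratedDeriv m K r =
        ∑ m ∈ Finset.Icc 0 j, (B n m : ℂ) * (r : ℂ) ^ m * iteratedDeriv m K r := by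
      refine Finset.sum_subset (fun m hm => ?_) fun m _ hm => ?_
      · rw [Finset.mem_range] at hm
        rw [Finset.mem_Icc]
        omega
      · rw [Finset.mem_range] at hm
        rw [B_eq_zero_of_lt (by omega)]
        simp
    rw [hext, Finset.sum_div, Finset.sum_mul, Finset.sum_mul, Finset.sum_mul, Finset.sum_mul]
    refine Finset.sum_congr rfl fun m _ => ?_
    rw [zpow_sub₀ hr0, zpow_natCast, zpow_natCast]
    push_cast
    rw [div_pow]
    field_simp
  · intro a ha b hb hab
    simp only [Finset.coe_Icc, Set.mem_Icc, Prod.mk.injEq] at ha hb hab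
    omega

lemma radialTerm_eq_zero_of_lt (hr : 0 < r) (hK : AnalyticOnNhd ℝ K (Set.Ioi 0)) {k j : ℕ}
    (h : j < k) : radialTerm d K k r' r j = 0 := by
  rw [radialTerm_eq_sum_fiber hr hK]
  refine Finset.sum_eq_zero fun p hp => ?_
  rw [mem_fiber] at hp
  rw [ZA_eq_zero_of_lt (by omega)]
  simp

/-- Regroup the summable (i, q) family along the finite fibers i + 2q = j; the terms with j < k
vanish. -/
lemma hasSum_radialTerm (hd : 2 ≤ d) (hr : 0 < r) (hr' : 0 ≤ r')
    (hK : AnalyticOnNhd ℝ K (Set.Ioi 0))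
    (hc : Summable fun n => ‖taylorCoeff K r n‖ * (r' / r * (r' / r + 2)) ^ n) (k : ℕ) :
    HasSum (fun i => radialTerm d K k r' r (k + i))
      (∑' p : ℕ × ℕ, expandTerm (taylorCoeff K r) (r' / r) p * (ZA d k p.1 : ℂ)) := by
  have hsum := (summable_expandTerm_mul_ZA hd (div_nonneg hr' hr.le) hc k).hasSum
  have h := ((Equiv.sigmaFiberEquiv fun p : ℕ × ℕ => p.1 + 2 * p.2).hasSum_iff.2 hsum).sigma
    (g := radialTerm d K k r' r) fun j => by
      let _ : Fintype {p : ℕ × ℕ // p.1 + 2 * p.2 = j} :=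
        Fintype.subtype (fiber j) fun _ => mem_fiber
      rw [radialTerm_eq_sum_fiber hr hK, Finset.sum_subtype (fiber j) fun _ => mem_fiber]
      exact hasSum_fintype _
  have h' := (hasSum_nat_add_iff' k).2 h
  rw [Finset.sum_eq_zero fun j hj => radialTerm_eq_zero_of_lt hr hK (Finset.mem_range.1 hj),
    sub_zero] at h'
  simpa only [add_comm k] using h'

lemma norm_inv_norm_smul {x : E d} (hx : x ≠ 0) : ‖‖x‖⁻¹ • x‖ = 1 := by
  rw [norm_smul, norm_inv, norm_norm, inv_mul_cancel₀ (norm_ne_zero_iff.2 hx)]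

lemma IsHarmonicBasis.apply_normalize {k : ℕ} {ι : Type*} {Y : ι → E d → ℂ}
    (hY : IsHarmonicBasis d k Y) (h : ι) {x : E d} (hx : x ≠ 0) : Y h (‖x‖⁻¹ • x) = Y h x := by
  obtain ⟨p, -, hp⟩ := hY.exists_solidHarmonic h
  rw [← hp, angularPart_apply_of_norm_eq_one p (FKT.norm_inv_norm_smul hx)]
  rfl

lemma IsHarmonicBasis.apply_eq_apply {ι : Type*} {Y : ι → E d → ℂ}
    (hY : IsHarmonicBasis d 0 Y) (h : ι) (x y : E d) : Y h x = Y h y := by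
  obtain ⟨p, hp, hpY⟩ := hY.exists_solidHarmonic h
  rw [← hpY, MvPolynomial.totalDegree_eq_zero_iff_eq_C.1
    ((MvPolynomial.totalDegree_zero_iff_isHomogeneous _).2 hp.1)]
  simp [angularPart]

lemma radialFactor_zero_left {k : ℕ} (hk : k ≠ 0) (r : ℝ) : radialFactor d K k 0 r = 0 := by
  simp [radialFactor, radialTerm, hk]

end FKT

end

/-! ### The expansion theorem -/

theorem theorem1 (d : ℕ) (hd : 2 ≤ d)
    (ι : ℕ → Type*) [∀ k, Fintype (ι k)]
    (Y : (k : ℕ) → ι k → FKT.E d → ℂ) (hY : ∀ k, FKT.IsHarmonicBasis d k (Y k))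
    (K : ℝ → ℂ) (hK : AnalyticOnNhd ℝ K (Set.Ioi 0))
    (x x' : FKT.E d) (hx : x ≠ 0)
    (hconv : ∀ γ : ℝ, ENNReal.ofReal |FKT.eps ‖x'‖ ‖x‖ γ| < FKT.taylorRadius K ‖x‖)
    (h0 : x' = x → ContinuousWithinAt K (Set.Ioi 0) 0) :
    (∀ k : ℕ, Summable fun i : ℕ => FKT.radialTerm d K k ‖x'‖ ‖x‖ (k + i)) ∧
    HasSum
      (fun k : ℕ => ∑ h : ι k,
        Y k h x * starRingEnd ℂ (Y k h x') * FKT.radialFactor d K k ‖x'‖ ‖x‖)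
      (K ‖x' - x‖) := by
  have hr : 0 < ‖x‖ := norm_pos_iff.2 hx
  have hs : 0 ≤ ‖x'‖ / ‖x‖ := by positivity
  have hc : Summable fun n =>
      ‖FKT.taylorCoeff K ‖x‖ n‖ * (‖x'‖ / ‖x‖ * (‖x'‖ / ‖x‖ + 2)) ^ n := by
    refine FKT.summable_norm_taylorCoeff (by positivity) ?_
    -- The angle π gives ε = s(s + 2), the majorant for every other angle.
    have := hconv Real.pi
    rwa [FKT.eps, Real.cos_pi, mul_neg_one, sub_neg_eq_add, abs_of_nonneg (by positivity)] at this
  have hrad := FKT.hasSum_radialTerm (d := d) hd hr (norm_nonneg x') hK hc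
  refine ⟨fun k => (hrad k).summable, ?_⟩
  set u : FKT.E d := ‖x‖⁻¹ • x with hu
  have hu1 : ‖u‖ = 1 := FKT.norm_inv_norm_smul hx
  -- If x' = 0 any unit vector serves as its direction: degree 0 harmonics are constant, and for k ≥
  -- 1 the radial factor is 0.
  obtain ⟨v, hv1, hv, hYv⟩ : ∃ v : FKT.E d, ‖v‖ = 1 ∧ x' = ‖x'‖ • v ∧ ∀ k h,
      starRingEnd ℂ (Y k h x') * FKT.radialFactor d K k ‖x'‖ ‖x‖ =
        starRingEnd ℂ (Y k h v) * FKT.radialFactor d K k ‖x'‖ ‖x‖ := by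
    by_cases hx' : x' = 0
    · refine ⟨u, hu1, by simp [hx'], fun k h => ?_⟩
      rcases k with _ | k
      · rw [(hY 0).apply_eq_apply h x' u]
      · rw [hx', norm_zero, FKT.radialFactor_zero_left (Nat.succ_ne_zero k), mul_zero, mul_zero]
    · refine ⟨‖x'‖⁻¹ • x', FKT.norm_inv_norm_smul hx', ?_, fun k h => ?_⟩
      · rw [smul_inv_smul₀ (norm_ne_zero_iff.2 hx')]
      · rw [(hY k).apply_normalize h hx']
  set s := ‖x'‖ / ‖x‖ with hs_def
  have hxu : x = ‖x‖ • u := by rw [hu, smul_inv_smul₀ hr.ne']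
  have hdist : ‖x' - x‖ ^ 2 = ‖x‖ ^ 2 * (1 + s * (s - 2 * inner ℝ u v)) := by
    have hin : inner ℝ x' x = ‖x'‖ * ‖x‖ * inner ℝ u v := by
      conv_lhs => rw [hv, hxu]
      rw [real_inner_smul_left, real_inner_smul_right, real_inner_comm]
      ring
    rw [norm_sub_sq_real, hin, hs_def]
    field_simp
    ring
  have hle : -1 ≤ s * (s - 2 * inner ℝ u v) := by
    by_contra hlt
    nlinarith [sq_nonneg ‖x' - x‖, pow_pos hr 2]
  have hsqrt : ‖x' - x‖ = ‖x‖ * √(1 + s * (s - 2 * inner ℝ u v)) := by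
    rw [← Real.sqrt_sq (norm_nonneg (x' - x)), hdist, Real.sqrt_mul (sq_nonneg _),
      Real.sqrt_sq hr.le]
  have hR : ENNReal.ofReal |s * (s - 2 * inner ℝ u v)| < FKT.taylorRadius K ‖x‖ := by
    have ht : |inner ℝ u v| ≤ 1 := by simpa [hu1, hv1] using abs_real_inner_le_norm u v
    have := hconv (Real.arccos (inner ℝ u v))
    rwa [FKT.eps, Real.cos_arccos (abs_le.1 ht).1 (abs_le.1 ht).2] at this
  -- The endpoint ε = -1 forces ‖x' - x‖ = 0, the one case in which continuity at 0 is assumed.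
  have hsum := FKT.hasSum_taylorCoeff hr hK hle hR fun h => h0 <| by
    rw [h] at hsqrt
    simpa [sub_eq_zero] using hsqrt
  rw [hsqrt]
  refine (FKT.hasSum_kernel_mul hd hY hu1 hv1 hs hc hsum).congr_fun fun k => ?_
  have hYu : ∀ h, Y k h x = Y k h u := fun h => ((hY k).apply_normalize h hx).symm
  rw [← (hrad k).tsum_eq, ← FKT.radialFactor, FKT.kernel, Finset.sum_mul]
  refine Finset.sum_congr rfl fun h _ => ?_
  rw [hYu, mul_assoc, hYv, mul_assoc]
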